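/- Let $\mathcal{C}$ be a symmetric monoidal category with unit object $\mathbf 1$. Definitions. For a bimonoid $A$ in $\mathcal{C}$ with counit $\epsilon_A$, a left action $\alpha : A\otimes X\to X$ is an associative and unital action of the monoid $A$ on an object $X$; the trivial left action is $\tau_{A,X} : A\otimes X \xrightarrow{\epsilon_A\otimes \mathrm{id}} \mathbf 1\otimes X\cong X$. The stabilized object $X\to\alpha\backslash X$ is a coequalizer of $\alpha$ and $\tau_{A,X}$. The invariant object $i:\alpha\backslash\backslash X\to X$ is universal among morphisms $f : Z\to X$ with $\alpha\circ(\mathrm{id}_A\otimes f)=f\circ\tau_{A,Z}$. Right actions are treated in the same way. Left and right coactions of bimonoids are treated dually: the stabilized object is an equalizer of the coaction and the trivial coaction, and the invariant object of a coaction on $Y$ is a universal morphism out of $Y$ which makes the coaction trivial. A bimonoid $A$ is small if for every left and every right action of $A$ the invariant and the stabilized object exist and the canonical morphism $\alpha\backslash\backslash X\to X\to\alpha\backslash X$ is an isomorphism; it is cosmall if for every left and every right coaction of $A$ both objects exist and the canonical morphism from the stabilized object through $Y$ to the invariant object is an isomorphism; it is bismall if it is small and cosmall. If $\mathcal{C}$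 has equalizers and coequalizers, taking stabilized objects is a comonoidal functor from left (right) actions of bimonoids to $\mathcal{C}$, and a monoidal functor from left (right) coactions of bimonoids to $\mathcal{C}$, where the tensor product of actions $(A,\alpha,X)$ and $(A',\alpha',X')$ is the induced action of $A\otimes A'$ on $X\otimes X'$, and similarly for coactions. The monoidal structure of $\mathcal{C}$ is bistable if these four functors are strongly monoidal, i.e. their canonical structure morphisms, for example $(\alpha\otimes\alpha')\backslash(X\otimes X')\to(\alpha\backslash X)\otimes(\alpha'\backslash X')$ for left actions, are isomorphisms. Let $\mathsf{Hopf}^{\mathsf{bc}}(\mathcal{C})$ be the category of bicommutative (commutative and cocommutative) Hopf monoids in $\mathcal{C}$ and bimonoid homomorphisms. Theorem. Suppose that (0) $\mathcal{C}$ has all equalizers and coequalizers; (1) the monoidal structure of $\mathcal{C}$ is bistable; (2) the category $\mathsf{Hopf}^{\mathsf{bc}}(\mathcal{C})$ is abelian. Then the full subcategory of bismall bicommutative Hopf monoids is closed under short exact sequences in $\mathsf{Hopf}^{\mathsf{bc}}(\mathcal{C})$: if $0\to A\to B\to C\to 0$ is a short exact sequence in $\mathsf{Hopf}^{\mathsf{bc}}(\mathcal{C})$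 and $A$ and $C$ are bismall, then $B$ is bismall. -/

import Mathlib

open CategoryTheory MonoidalCategory Limits
open scoped MonObj ComonObj

universe v u

namespace HopfExt

section Actions

variable {C : Type u} [Category.{v} C] [MonoidalCategory C]

/-! ### Actions and coactions -/

/-- A left action of the monoid `A` on an object `X`. -/
structure LeftAction (A X : C) [MonObj A] where
  act : A ⊗ X ⟶ X
  one_act : η[A] ▷ X ≫ act = (λ_ X).hom
  mul_act : μ[A] ▷ X ≫ act = (α_ A A X).hom ≫ A ◁ act ≫ act

/-- A right action of the monoid `A` on an object `X`. -/
structure RightAction (X A : C) [MonObj A] where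
  act : X ⊗ A ⟶ X
  act_one : X ◁ η[A] ≫ act = (ρ_ X).hom
  act_mul : X ◁ μ[A] ≫ act = (α_ X A A).inv ≫ act ▷ A ≫ act

/-- A left coaction of the comonoid `B` on an object `Y`. -/
structure LeftCoaction (B Y : C) [ComonObj B] where
  coact : Y ⟶ B ⊗ Y
  coact_counit : coact ≫ ε[B] ▷ Y = (λ_ Y).inv
  coact_comul : coact ≫ Δ[B] ▷ Y = coact ≫ B ◁ coact ≫ (α_ B B Y).inv

/-- A right coaction of the comonoid `B` on an object `Y`. -/
structure RightCoaction (Y B : C) [ComonObj B] where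
  coact : Y ⟶ Y ⊗ B
  coact_counit : coact ≫ Y ◁ ε[B] = (ρ_ Y).inv
  coact_comul : coact ≫ Y ◁ Δ[B] = coact ≫ coact ▷ B ≫ (α_ Y B B).hom

/-- The structure morphism of the trivial left action. -/
abbrev trivLeftAct (A X : C) [ComonObj A] : A ⊗ X ⟶ X := ε[A] ▷ X ≫ (λ_ X).hom

/-- The structure morphism of the trivial right action. -/
abbrev trivRightAct (X A : C) [ComonObj A] : X ⊗ A ⟶ X := X ◁ ε[A] ≫ (ρ_ X).hom

/-- The structure morphism of the trivial left coaction. -/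
abbrev trivLeftCoact (B Y : C) [MonObj B] : Y ⟶ B ⊗ Y := (λ_ Y).inv ≫ η[B] ▷ Y

/-- The structure morphism of the trivial right coaction. -/
abbrev trivRightCoact (Y B : C) [MonObj B] : Y ⟶ Y ⊗ B := (ρ_ Y).inv ≫ Y ◁ η[B]

/-! ### Invariant objects -/

/-- `i : I ⟶ X` is an invariant object of the left action `a`: the action restricted along `i` is
trivial, and `i` is universal with this property. -/
structure LeftAction.IsInvariant {A X : C} [MonObj A] [ComonObj A] (a : LeftAction A X)
    {I : C} (i : I ⟶ X) : Prop where
  condition : A ◁ i ≫ a.act = trivLeftAct A I ≫ i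
  existsUnique_lift : ∀ {Z : C} (f : Z ⟶ X), A ◁ f ≫ a.act = trivLeftAct A Z ≫ f →
    ∃! g : Z ⟶ I, g ≫ i = f

/-- `i : I ⟶ X` is an invariant object of the right action `a`. -/
structure RightAction.IsInvariant {X A : C} [MonObj A] [ComonObj A] (a : RightAction X A)
    {I : C} (i : I ⟶ X) : Prop where
  condition : i ▷ A ≫ a.act = trivRightAct I A ≫ i
  existsUnique_lift : ∀ {Z : C} (f : Z ⟶ X), f ▷ A ≫ a.act = trivRightAct Z A ≫ f →
    ∃! g : Z ⟶ I, g ≫ i = f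

/-- `p : Y ⟶ Q` is an invariant object of the left coaction `b` (the notion dual to that for
actions): `p` makes the coaction trivial, and is universal with this property. -/
structure LeftCoaction.IsInvariant {B Y : C} [MonObj B] [ComonObj B] (b : LeftCoaction B Y)
    {Q : C} (p : Y ⟶ Q) : Prop where
  condition : b.coact ≫ B ◁ p = p ≫ trivLeftCoact B Q
  existsUnique_desc : ∀ {Z : C} (f : Y ⟶ Z), b.coact ≫ B ◁ f = f ≫ trivLeftCoact B Z →
    ∃! g : Q ⟶ Z, p ≫ g = f

/-- `p : Y ⟶ Q` is an invariant object of the right coaction `b`. -/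
structure RightCoaction.IsInvariant {Y B : C} [MonObj B] [ComonObj B] (b : RightCoaction Y B)
    {Q : C} (p : Y ⟶ Q) : Prop where
  condition : b.coact ≫ p ▷ B = p ≫ trivRightCoact Q B
  existsUnique_desc : ∀ {Z : C} (f : Y ⟶ Z), b.coact ≫ f ▷ B = f ≫ trivRightCoact Z B →
    ∃! g : Q ⟶ Z, p ≫ g = f

end Actions

section Small

variable {C : Type u} [Category.{v} C] [MonoidalCategory C] [BraidedCategory C]

/-! ### Small, cosmall and bismall bimonoids

The stabilized object of an action is a coequalizer of the action and the trivial action; that of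
a coaction is an equalizer of the coaction and the trivial coaction. Invariant and stabilized
objects are unique up to unique isomorphism, so it does not matter which ones are chosen. -/

/-- A bimonoid `A` is small if every left (right) action of `A` has an invariant object and a
stabilized object and the canonical morphism from the former to the latter is an isomorphism. -/
structure IsSmall (A : C) [BimonObj A] : Prop where
  left : ∀ {X : C} (a : LeftAction A X),
    ∃ (I : C) (i : I ⟶ X) (c : Cofork a.act (trivLeftAct A X)),
      a.IsInvariant i ∧ Nonempty (IsColimit c) ∧ IsIso (i ≫ c.π)
  right : ∀ {X : C} (a : RightAction X A),
    ∃ (I : C) (i : I ⟶ X) (c : Cofork a.act (trivRightAct X A)),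
      a.IsInvariant i ∧ Nonempty (IsColimit c) ∧ IsIso (i ≫ c.π)

/-- A bimonoid `B` is cosmall if every left (right) coaction of `B` has an invariant object and a
stabilized object and the canonical morphism from the latter to the former is an isomorphism. -/
structure IsCosmall (B : C) [BimonObj B] : Prop where
  left : ∀ {Y : C} (b : LeftCoaction B Y),
    ∃ (Q : C) (p : Y ⟶ Q) (c : Fork b.coact (trivLeftCoact B Y)),
      b.IsInvariant p ∧ Nonempty (IsLimit c) ∧ IsIso (c.ι ≫ p)
  right : ∀ {Y : C} (b : RightCoaction Y B),
    ∃ (Q : C) (p : Y ⟶ Q) (c : Fork b.coact (trivRightCoact Y B)),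
      b.IsInvariant p ∧ Nonempty (IsLimit c) ∧ IsIso (c.ι ≫ p)

/-- A bimonoid is bismall if it is small and cosmall. -/
structure IsBismall (A : C) [BimonObj A] : Prop where
  small : IsSmall A
  cosmall : IsCosmall A

/-! ### Tensor products of actions and coactions -/

/-- The action of `A ⊗ A'` on `X ⊗ X'`. -/
def LeftAction.tensor {A X A' X' : C} [MonObj A] [MonObj A']
    (a : LeftAction A X) (a' : LeftAction A' X') : LeftAction (A ⊗ A') (X ⊗ X') where
  act := tensorμ A A' X X' ≫ (a.act ⊗ₘ a'.act)
  one_act := by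
    rw [MonObj.tensorObj.one_def, comp_whiskerRight, Category.assoc, tensorμ_natural_left_assoc,
      tensorHom_comp_tensorHom, a.one_act, a'.one_act, tensor_left_unitality]
  mul_act := by
    rw [MonObj.tensorObj.mul_def, comp_whiskerRight, Category.assoc, tensorμ_natural_left_assoc,
      tensorHom_comp_tensorHom, a.mul_act, a'.mul_act, ← tensorHom_comp_tensorHom,
      tensor_associativity_assoc, MonoidalCategory.whiskerLeft_comp, Category.assoc,
      tensorμ_natural_right_assoc, tensorHom_comp_tensorHom]

/-- The action of `A ⊗ A'` on `X ⊗ X'`. -/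
def RightAction.tensor {X A X' A' : C} [MonObj A] [MonObj A']
    (a : RightAction X A) (a' : RightAction X' A') : RightAction (X ⊗ X') (A ⊗ A') where
  act := tensorμ X X' A A' ≫ (a.act ⊗ₘ a'.act)
  act_one := by
    rw [MonObj.tensorObj.one_def, MonoidalCategory.whiskerLeft_comp, Category.assoc,
      tensorμ_natural_right_assoc,
      tensorHom_comp_tensorHom, a.act_one, a'.act_one, tensor_right_unitality]
  act_mul := by
    have h := tensor_associativity X X' A A' A A'
    rw [MonObj.tensorObj.mul_def, MonoidalCategory.whiskerLeft_comp, Category.assoc,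
      tensorμ_natural_right_assoc,
      tensorHom_comp_tensorHom, a.act_mul, a'.act_mul, ← tensorHom_comp_tensorHom]
    rw [Iso.eq_inv_comp, comp_whiskerRight, Category.assoc, tensorμ_natural_left_assoc,
      tensorHom_comp_tensorHom, ← reassoc_of% h, tensorHom_comp_tensorHom, tensorHom_comp_tensorHom,
      Iso.hom_inv_id_assoc, Iso.hom_inv_id_assoc]

lemma whiskerRight_tensorμ {X X' Y Y' : C} (f : X ⟶ Y) (f' : X' ⟶ Y') (Z Z' : C) :
    (f ▷ Z ⊗ₘ f' ▷ Z') ≫ tensorμ Y Z Y' Z' = tensorμ X Z X' Z' ≫ (f ⊗ₘ f') ▷ (Z ⊗ Z') := by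
  have h := tensorμ_natural f (𝟙 Z) f' (𝟙 Z')
  simpa using h

lemma whiskerLeft_tensorμ {X X' Y Y' : C} (Z Z' : C) (f : X ⟶ Y) (f' : X' ⟶ Y') :
    (Z ◁ f ⊗ₘ Z' ◁ f') ≫ tensorμ Z Y Z' Y' = tensorμ Z X Z' X' ≫ (Z ⊗ Z') ◁ (f ⊗ₘ f') := by
  have h := tensorμ_natural (𝟙 Z) f (𝟙 Z') f'
  simpa using h

/-- The coaction of `B ⊗ B'` on `Y ⊗ Y'`. -/
def LeftCoaction.tensor {B Y B' Y' : C} [ComonObj B] [ComonObj B']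
    (b : LeftCoaction B Y) (b' : LeftCoaction B' Y') : LeftCoaction (B ⊗ B') (Y ⊗ Y') where
  coact := (b.coact ⊗ₘ b'.coact) ≫ tensorμ B Y B' Y'
  coact_counit := by
    have h := whiskerRight_tensorμ ε[B] ε[B'] Y Y'
    have h' := leftUnitor_monoidal Y Y'
    rw [Comon.tensorObj_counit, comp_whiskerRight, Category.assoc, ← reassoc_of% h,
      tensorHom_comp_tensorHom_assoc, b.coact_counit, b'.coact_counit,
      ← cancel_mono (λ_ (Y ⊗ Y')).hom, Category.assoc, Category.assoc, ← h',
      tensorHom_comp_tensorHom]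
    simp
  coact_comul := by
    have h := whiskerRight_tensorμ Δ[B] Δ[B'] Y Y'
    have h' := whiskerLeft_tensorμ B B' b.coact b'.coact
    have h'' := associator_monoidal B B Y B' B' Y'
    rw [Comon.tensorObj_comul, comp_whiskerRight, Category.assoc, ← reassoc_of% h,
      tensorHom_comp_tensorHom_assoc, b.coact_comul, b'.coact_comul,
      MonoidalCategory.whiskerLeft_comp, Category.assoc, Category.assoc, ← reassoc_of% h',
      tensorHom_comp_tensorHom_assoc, ← cancel_mono (α_ (B ⊗ B') (B ⊗ B') (Y ⊗ Y')).hom]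
    simp only [Category.assoc, Iso.inv_hom_id, Category.comp_id]
    rw [h'', tensorHom_comp_tensorHom_assoc]
    simp only [Category.assoc, Iso.inv_hom_id, Category.comp_id]

/-- The coaction of `B ⊗ B'` on `Y ⊗ Y'`. -/
def RightCoaction.tensor {Y B Y' B' : C} [ComonObj B] [ComonObj B']
    (b : RightCoaction Y B) (b' : RightCoaction Y' B') : RightCoaction (Y ⊗ Y') (B ⊗ B') where
  coact := (b.coact ⊗ₘ b'.coact) ≫ tensorμ Y B Y' B'
  coact_counit := by
    have h := whiskerLeft_tensorμ Y Y' ε[B] ε[B']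
    have h' := rightUnitor_monoidal Y Y'
    rw [Comon.tensorObj_counit, MonoidalCategory.whiskerLeft_comp, Category.assoc,
      ← reassoc_of% h,
      tensorHom_comp_tensorHom_assoc, b.coact_counit, b'.coact_counit,
      ← cancel_mono (ρ_ (Y ⊗ Y')).hom, Category.assoc, Category.assoc, ← h',
      tensorHom_comp_tensorHom]
    simp
  coact_comul := by
    have h := whiskerLeft_tensorμ Y Y' Δ[B] Δ[B']
    have h' := whiskerRight_tensorμ b.coact b'.coact B B'
    have h'' := associator_monoidal Y B B Y' B' B'
    rw [Comon.tensorObj_comul, MonoidalCategory.whiskerLeft_comp, Category.assoc,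
      ← reassoc_of% h,
      tensorHom_comp_tensorHom_assoc, b.coact_comul, b'.coact_comul,
      comp_whiskerRight, Category.assoc, Category.assoc, ← reassoc_of% h',
      tensorHom_comp_tensorHom_assoc, h'', tensorHom_comp_tensorHom_assoc]
    simp only [Category.assoc]

/-! ### Stability of the monoidal structure

Taking stabilized objects is comonoidal on actions and monoidal on coactions. The structure
morphisms for tensor products are the canonical morphisms below. The structure morphism for the
unit compares the stabilized object of the trivial (co)action on `𝟙_ C` with `𝟙_ C`; it is always
an isomorphism, so that strong monoidality is the invertibility of the morphisms below. -/

lemma tensorμ_trivLeftAct (A X A' X' : C) [ComonObj A] [ComonObj A'] :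
    tensorμ A A' X X' ≫ (trivLeftAct A X ⊗ₘ trivLeftAct A' X') =
      trivLeftAct (A ⊗ A') (X ⊗ X') := by
  rw [trivLeftAct, trivLeftAct, trivLeftAct, ← tensorHom_comp_tensorHom,
    ← tensorμ_natural_left_assoc, Comon.tensorObj_counit, comp_whiskerRight, Category.assoc,
    tensor_left_unitality X X', hom_inv_whiskerRight_assoc]

lemma tensorμ_trivRightAct (X A X' A' : C) [ComonObj A] [ComonObj A'] :
    tensorμ X X' A A' ≫ (trivRightAct X A ⊗ₘ trivRightAct X' A') =
      trivRightAct (X ⊗ X') (A ⊗ A') := by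
  rw [trivRightAct, trivRightAct, trivRightAct, ← tensorHom_comp_tensorHom,
    ← tensorμ_natural_right_assoc, Comon.tensorObj_counit, MonoidalCategory.whiskerLeft_comp,
    Category.assoc, tensor_right_unitality X X', whiskerLeft_hom_inv_assoc]

lemma trivLeftCoact_tensorμ (B Y B' Y' : C) [MonObj B] [MonObj B'] :
    (trivLeftCoact B Y ⊗ₘ trivLeftCoact B' Y') ≫ tensorμ B Y B' Y' =
      trivLeftCoact (B ⊗ B') (Y ⊗ Y') := by
  have h := whiskerRight_tensorμ η[B] η[B'] Y Y'
  rw [trivLeftCoact, trivLeftCoact, trivLeftCoact, ← tensorHom_comp_tensorHom, Category.assoc, h,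
    MonObj.tensorObj.one_def, comp_whiskerRight]
  have h' := leftUnitor_monoidal Y Y'
  rw [← cancel_epi ((λ_ Y).hom ⊗ₘ (λ_ Y').hom), tensorHom_comp_tensorHom_assoc, h']
  simp

lemma trivRightCoact_tensorμ (Y B Y' B' : C) [MonObj B] [MonObj B'] :
    (trivRightCoact Y B ⊗ₘ trivRightCoact Y' B') ≫ tensorμ Y B Y' B' =
      trivRightCoact (Y ⊗ Y') (B ⊗ B') := by
  have h := whiskerLeft_tensorμ Y Y' η[B] η[B']
  rw [trivRightCoact, trivRightCoact, trivRightCoact, ← tensorHom_comp_tensorHom, Category.assoc,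
    h, MonObj.tensorObj.one_def, MonoidalCategory.whiskerLeft_comp]
  have h' := rightUnitor_monoidal Y Y'
  rw [← cancel_epi ((ρ_ Y).hom ⊗ₘ (ρ_ Y').hom), tensorHom_comp_tensorHom_assoc, h']
  simp

noncomputable section

variable [HasCoequalizers C]

/-- The stabilized object `α \ X` of a left action. -/
abbrev LeftAction.stab {A X : C} [BimonObj A] (a : LeftAction A X) : C :=
  coequalizer a.act (trivLeftAct A X)

/-- The stabilized object `X / α` of a right action. -/
abbrev RightAction.stab {X A : C} [BimonObj A] (a : RightAction X A) : C :=
  coequalizer a.act (trivRightAct X A)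

/-- The canonical morphism `(α ⊗ α') \ (X ⊗ X') ⟶ (α \ X) ⊗ (α' \ X')`. -/
def LeftAction.stabTensor {A X A' X' : C} [BimonObj A] [BimonObj A']
    (a : LeftAction A X) (a' : LeftAction A' X') :
    coequalizer (a.tensor a').act (trivLeftAct (A ⊗ A') (X ⊗ X')) ⟶ a.stab ⊗ a'.stab :=
  coequalizer.desc (coequalizer.π a.act (trivLeftAct A X) ⊗ₘ
    coequalizer.π a'.act (trivLeftAct A' X')) (by
      rw [← tensorμ_trivLeftAct, LeftAction.tensor, Category.assoc, Category.assoc,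
        tensorHom_comp_tensorHom, tensorHom_comp_tensorHom, coequalizer.condition,
        coequalizer.condition])

/-- The canonical morphism `(X ⊗ X') / (α ⊗ α') ⟶ (X / α) ⊗ (X' / α')`. -/
def RightAction.stabTensor {X A X' A' : C} [BimonObj A] [BimonObj A']
    (a : RightAction X A) (a' : RightAction X' A') :
    coequalizer (a.tensor a').act (trivRightAct (X ⊗ X') (A ⊗ A')) ⟶ a.stab ⊗ a'.stab :=
  coequalizer.desc (coequalizer.π a.act (trivRightAct X A) ⊗ₘ
    coequalizer.π a'.act (trivRightAct X' A')) (by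
      rw [← tensorμ_trivRightAct, RightAction.tensor, Category.assoc, Category.assoc,
        tensorHom_comp_tensorHom, tensorHom_comp_tensorHom, coequalizer.condition,
        coequalizer.condition])

variable (C) in
/-- The monoidal structure of `C` is stable: taking stabilized objects of left actions, and of
right actions, of bimonoids is strong monoidal. -/
structure IsStable : Prop where
  left : ∀ {A X A' X' : C} [BimonObj A] [BimonObj A'] (a : LeftAction A X) (a' : LeftAction A' X'),
    IsIso (a.stabTensor a')
  right : ∀ {X A X' A' : C} [BimonObj A] [BimonObj A'] (a : RightAction X A)
    (a' : RightAction X' A'), IsIso (a.stabTensor a')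

end

noncomputable section

variable [HasEqualizers C]

/-- The stabilized object `β / Y` of a left coaction. -/
abbrev LeftCoaction.stab {B Y : C} [BimonObj B] (b : LeftCoaction B Y) : C :=
  equalizer b.coact (trivLeftCoact B Y)

/-- The stabilized object `Y \ β` of a right coaction. -/
abbrev RightCoaction.stab {Y B : C} [BimonObj B] (b : RightCoaction Y B) : C :=
  equalizer b.coact (trivRightCoact Y B)

/-- The canonical morphism `(β / Y) ⊗ (β' / Y') ⟶ (β ⊗ β') / (Y ⊗ Y')`. -/
def LeftCoaction.stabTensor {B Y B' Y' : C} [BimonObj B] [BimonObj B']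
    (b : LeftCoaction B Y) (b' : LeftCoaction B' Y') :
    b.stab ⊗ b'.stab ⟶ equalizer (b.tensor b').coact (trivLeftCoact (B ⊗ B') (Y ⊗ Y')) :=
  equalizer.lift (equalizer.ι b.coact (trivLeftCoact B Y) ⊗ₘ
    equalizer.ι b'.coact (trivLeftCoact B' Y')) (by
      rw [← trivLeftCoact_tensorμ, LeftCoaction.tensor, tensorHom_comp_tensorHom_assoc,
        tensorHom_comp_tensorHom_assoc, equalizer.condition, equalizer.condition])

/-- The canonical morphism `(Y \ β) ⊗ (Y' \ β') ⟶ (Y ⊗ Y') \ (β ⊗ β')`. -/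
def RightCoaction.stabTensor {Y B Y' B' : C} [BimonObj B] [BimonObj B']
    (b : RightCoaction Y B) (b' : RightCoaction Y' B') :
    b.stab ⊗ b'.stab ⟶ equalizer (b.tensor b').coact (trivRightCoact (Y ⊗ Y') (B ⊗ B')) :=
  equalizer.lift (equalizer.ι b.coact (trivRightCoact Y B) ⊗ₘ
    equalizer.ι b'.coact (trivRightCoact Y' B')) (by
      rw [← trivRightCoact_tensorμ, RightCoaction.tensor, tensorHom_comp_tensorHom_assoc,
        tensorHom_comp_tensorHom_assoc, equalizer.condition, equalizer.condition])

variable (C) in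
/-- The monoidal structure of `C` is costable: taking stabilized objects of left coactions, and of
right coactions, of bimonoids is strong monoidal. -/
structure IsCostable : Prop where
  left : ∀ {B Y B' Y' : C} [BimonObj B] [BimonObj B'] (b : LeftCoaction B Y)
    (b' : LeftCoaction B' Y'), IsIso (b.stabTensor b')
  right : ∀ {Y B Y' B' : C} [BimonObj B] [BimonObj B'] (b : RightCoaction Y B)
    (b' : RightCoaction Y' B'), IsIso (b.stabTensor b')

end

variable (C) in
/-- The monoidal structure of `C` is bistable if it is stable and costable. -/
structure IsBistable [HasEqualizers C] [HasCoequalizers C] : Prop where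
  stable : IsStable C
  costable : IsCostable C

/-! ### Bicommutative Hopf monoids -/

variable (C) in
/-- Bicommutativity, as a property of Hopf monoids. -/
def isBicommutative : ObjectProperty (Hopf C) :=
  fun A => IsCommMonObj A.X ∧ IsCommComonObj A.X

variable (C) in
/-- The category of bicommutative Hopf monoids in `C` and bimonoid homomorphisms. -/
abbrev HopfBC : Type (max u v) := (isBicommutative C).FullSubcategory

variable (C) in
/-- Bismallness, as a property of bicommutative Hopf monoids. -/
def isBismall : ObjectProperty (HopfBC C) :=
  fun A => IsBismall A.obj.X

end Small

end HopfExt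

namespace HopfExt

section Transfer

variable {C : Type u} [Category.{v} C] [MonoidalCategory C]

instance isSplitEpi_tensorHom {W X Y Z : C} (f : W ⟶ X) (g : Y ⟶ Z) [IsSplitEpi f]
    [IsSplitEpi g] : IsSplitEpi (f ⊗ₘ g) :=
  ⟨⟨⟨section_ f ⊗ₘ section_ g, by simp⟩⟩⟩

instance isSplitMono_tensorHom {W X Y Z : C} (f : W ⟶ X) (g : Y ⟶ Z) [IsSplitMono f]
    [IsSplitMono g] : IsSplitMono (f ⊗ₘ g) :=
  ⟨⟨⟨retraction f ⊗ₘ retraction g, by simp⟩⟩⟩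

variable [BraidedCategory C]

/-- A Hopf monoid structure on the target of a split epimorphism from a Hopf monoid, given
structure morphisms compatible with those of the source. -/
abbrev hopfObjOfSplitEpi {B Q : C} [HopfObj B] (π : B ⟶ Q) [IsSplitEpi π]
    (m : Q ⊗ Q ⟶ Q) (d : Q ⟶ Q ⊗ Q) (e : Q ⟶ 𝟙_ C) (S : Q ⟶ Q)
    (hm : (π ⊗ₘ π) ≫ m = μ[B] ≫ π) (hd : π ≫ d = Δ[B] ≫ (π ⊗ₘ π))
    (he : π ≫ e = ε[B]) (hS : π ≫ S = HopfObj.antipode ≫ π) : HopfObj Q :=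
  have hm' {X Y : C} (x : X ⟶ B) (y : Y ⟶ B) :
      (x ≫ π ⊗ₘ y ≫ π) ≫ m = (x ⊗ₘ y) ≫ μ[B] ≫ π := by
    rw [← tensorHom_comp_tensorHom_assoc, hm]
  have hm₁ {X : C} (x : X ⟶ B) : (x ≫ π ⊗ₘ π) ≫ m = (x ▷ B) ≫ μ[B] ≫ π := by
    simpa using hm' x (𝟙 B)
  have hm₂ {X : C} (x : X ⟶ B) : (π ⊗ₘ x ≫ π) ≫ m = (B ◁ x) ≫ μ[B] ≫ π := by
    simpa using hm' (𝟙 B) x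
  { one := η[B] ≫ π
    mul := m
    counit := e
    comul := d
    antipode := S
    one_mul := by
      rw [← cancel_epi (𝟙 (𝟙_ C) ⊗ₘ π), ← tensorHom_id, tensorHom_comp_tensorHom_assoc,
        Category.id_comp, Category.comp_id, hm₁]
      simp
    mul_one := by
      rw [← cancel_epi (π ⊗ₘ 𝟙 (𝟙_ C)), ← id_tensorHom, tensorHom_comp_tensorHom_assoc,
        Category.id_comp, Category.comp_id, hm₂]
      simp
    mul_assoc := by
      rw [← cancel_epi ((π ⊗ₘ π) ⊗ₘ π), ← tensorHom_id, tensorHom_comp_tensorHom_assoc, hm,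
        associator_naturality_assoc, ← id_tensorHom, tensorHom_comp_tensorHom_assoc, hm,
        Category.comp_id, hm₁, hm₂]
      simp
    counit_comul := by
      rw [← cancel_epi π, reassoc_of% hd, ← tensorHom_id, tensorHom_comp_tensorHom, he]
      simp [MonoidalCategory.tensorHom_def]
    comul_counit := by
      rw [← cancel_epi π, reassoc_of% hd, ← id_tensorHom, tensorHom_comp_tensorHom, he]
      simp [MonoidalCategory.tensorHom_def']
    comul_assoc := by
      have h₁ : (π ⊗ₘ Δ[B] ≫ (π ⊗ₘ π)) = B ◁ Δ[B] ≫ (π ⊗ₘ (π ⊗ₘ π)) := by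
        rw [← id_tensorHom, tensorHom_comp_tensorHom, Category.id_comp]
      have h₂ : (Δ[B] ≫ (π ⊗ₘ π) ⊗ₘ π) = Δ[B] ▷ B ≫ ((π ⊗ₘ π) ⊗ₘ π) := by
        rw [← tensorHom_id, tensorHom_comp_tensorHom, Category.id_comp]
      rw [← cancel_epi π, reassoc_of% hd, reassoc_of% hd, ← id_tensorHom, ← tensorHom_id,
        tensorHom_comp_tensorHom, tensorHom_comp_tensorHom_assoc, hd, Category.comp_id, h₁, h₂,
        ComonObj.comul_assoc_assoc, Category.assoc, associator_naturality]
    mul_comul := by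
      rw [← cancel_epi (π ⊗ₘ π), reassoc_of% hm, hd, tensorHom_comp_tensorHom_assoc, hd,
        ← tensorHom_comp_tensorHom_assoc, tensorμ_natural_assoc, tensorHom_comp_tensorHom, hm]
      simp
    one_comul := by
      have h := BimonObj.one_comul B
      rw [MonObj.tensorObj.one_def] at h
      rw [Category.assoc, hd, reassoc_of% h, tensorHom_comp_tensorHom]
      rfl
    mul_counit := by
      have h := BimonObj.mul_counit B
      rw [Comon.tensorObj_counit] at h
      change m ≫ e = (e ⊗ₘ e) ≫ (λ_ (𝟙_ C)).hom
      rw [← cancel_epi (π ⊗ₘ π), reassoc_of% hm, he, h, tensorHom_comp_tensorHom_assoc, he]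
    one_counit := by rw [Category.assoc, he]; simp
    antipode_left := by
      rw [← cancel_epi π, reassoc_of% hd, ← tensorHom_id, tensorHom_comp_tensorHom_assoc, hS,
        reassoc_of% he, Category.comp_id, hm₁]
      simp
    antipode_right := by
      rw [← cancel_epi π, reassoc_of% hd, ← id_tensorHom, tensorHom_comp_tensorHom_assoc, hS,
        reassoc_of% he, Category.comp_id, hm₂]
      simp }

/-- A Hopf monoid structure on the source of a split monomorphism to a Hopf monoid, given
structure morphisms compatible with those of the target. -/
abbrev hopfObjOfSplitMono {K B : C} [HopfObj B] (i : K ⟶ B) [IsSplitMono i]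
    (o : 𝟙_ C ⟶ K) (m : K ⊗ K ⟶ K) (d : K ⟶ K ⊗ K) (S : K ⟶ K)
    (ho : o ≫ i = η[B]) (hm : m ≫ i = (i ⊗ₘ i) ≫ μ[B]) (hd : d ≫ (i ⊗ₘ i) = i ≫ Δ[B])
    (hS : S ≫ i = i ≫ HopfObj.antipode) : HopfObj K :=
  have hd' {X Y : C} (x : B ⟶ X) (y : B ⟶ Y) :
      d ≫ (i ≫ x ⊗ₘ i ≫ y) = i ≫ Δ[B] ≫ (x ⊗ₘ y) := by
    rw [← tensorHom_comp_tensorHom, reassoc_of% hd]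
  have hd₁ {X : C} (x : B ⟶ X) : d ≫ (i ≫ x ⊗ₘ i) = i ≫ Δ[B] ≫ x ▷ B := by
    simpa using hd' x (𝟙 B)
  have hd₂ {X : C} (x : B ⟶ X) : d ≫ (i ⊗ₘ i ≫ x) = i ≫ Δ[B] ≫ B ◁ x := by
    simpa using hd' (𝟙 B) x
  { one := o
    mul := m
    counit := i ≫ ε[B]
    comul := d
    antipode := S
    one_mul := by
      rw [← cancel_mono i, Category.assoc, hm, ← tensorHom_id, tensorHom_comp_tensorHom_assoc, ho]
      simp [MonoidalCategory.tensorHom_def']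
    mul_one := by
      rw [← cancel_mono i, Category.assoc, hm, ← id_tensorHom, tensorHom_comp_tensorHom_assoc, ho]
      simp [MonoidalCategory.tensorHom_def]
    mul_assoc := by
      have h₁ : (i ⊗ₘ (i ⊗ₘ i) ≫ μ[B]) = (i ⊗ₘ (i ⊗ₘ i)) ≫ B ◁ μ[B] := by
        rw [← id_tensorHom, tensorHom_comp_tensorHom, Category.comp_id]
      have h₂ : ((i ⊗ₘ i) ≫ μ[B] ⊗ₘ i) = ((i ⊗ₘ i) ⊗ₘ i) ≫ μ[B] ▷ B := by
        rw [← tensorHom_id, tensorHom_comp_tensorHom, Category.comp_id]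
      simp only [← cancel_mono i, Category.assoc, hm]
      rw [← id_tensorHom, ← tensorHom_id, tensorHom_comp_tensorHom_assoc,
        tensorHom_comp_tensorHom_assoc, hm, Category.id_comp, h₁, h₂, Category.assoc,
        MonObj.mul_assoc, Category.assoc, associator_naturality_assoc]
    counit_comul := by
      rw [← cancel_mono (𝟙 (𝟙_ C) ⊗ₘ i), Category.assoc, ← tensorHom_id, tensorHom_comp_tensorHom,
        Category.id_comp, Category.comp_id, hd₁]
      simp
    comul_counit := by
      rw [← cancel_mono (i ⊗ₘ 𝟙 (𝟙_ C)), Category.assoc, ← id_tensorHom, tensorHom_comp_tensorHom,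
        Category.id_comp, Category.comp_id, hd₂]
      simp
    comul_assoc := by
      simp only [← cancel_mono (i ⊗ₘ i ⊗ₘ i), Category.assoc]
      rw [← associator_naturality, ← id_tensorHom, ← tensorHom_id, tensorHom_comp_tensorHom,
        tensorHom_comp_tensorHom_assoc, hd, Category.id_comp, hd₂, reassoc_of% hd₁]
      simp
    mul_comul := by
      simp only [← cancel_mono (i ⊗ₘ i), Category.assoc]
      rw [hd, tensorHom_comp_tensorHom, hm, ← tensorHom_comp_tensorHom, ← tensorμ_natural_assoc,
        tensorHom_comp_tensorHom_assoc, hd, reassoc_of% hm, BimonObj.mul_comul,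
        tensorHom_comp_tensorHom_assoc]
    one_comul := by
      have h := BimonObj.one_comul B
      rw [MonObj.tensorObj.one_def] at h
      rw [← cancel_mono (i ⊗ₘ i), Category.assoc, hd, reassoc_of% ho, h]
      change _ = ((λ_ (𝟙_ C)).inv ≫ (o ⊗ₘ o)) ≫ _
      rw [Category.assoc, tensorHom_comp_tensorHom, ho]
    mul_counit := by
      have h := BimonObj.mul_counit B
      rw [Comon.tensorObj_counit] at h
      rw [reassoc_of% hm, h, tensorHom_comp_tensorHom_assoc]
      rfl
    one_counit := by rw [reassoc_of% ho]; simp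
    antipode_left := by
      simp only [← cancel_mono i, Category.assoc, hm, ho]
      rw [← tensorHom_id, tensorHom_comp_tensorHom_assoc, hS, Category.id_comp, reassoc_of% hd₁]
      simp
    antipode_right := by
      simp only [← cancel_mono i, Category.assoc, hm, ho]
      rw [← id_tensorHom, tensorHom_comp_tensorHom_assoc, hS, Category.id_comp, reassoc_of% hd₂]
      simp }

end Transfer

section Bridge
variable {C : Type u} [Category.{v} C] [MonoidalCategory C] [BraidedCategory C]

/-- The morphism of `C` underlying a morphism of bicommutative Hopf monoids. -/
abbrev HopfBC.toHom {A B : HopfBC C} (f : A ⟶ B) : A.obj.X ⟶ B.obj.X :=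
  f.hom.hom.hom.hom

instance HopfBC.isBimonHom_toHom {A B : HopfBC C} (f : A ⟶ B) : IsBimonHom (HopfBC.toHom f) where
  one_hom := f.hom.hom.hom.isMonHom_hom.one_hom
  mul_hom := f.hom.hom.hom.isMonHom_hom.mul_hom
  hom_counit := congrArg Mon.Hom.hom f.hom.hom.isComonHom_hom.hom_counit
  hom_comul := congrArg Mon.Hom.hom f.hom.hom.isComonHom_hom.hom_comul

lemma HopfBC.toHom_injective {A B : HopfBC C} {f g : A ⟶ B}
    (h : HopfBC.toHom f = HopfBC.toHom g) : f = g :=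
  ObjectProperty.hom_ext _ (InducedCategory.hom_ext (Bimon.ext h))

@[simp]
lemma HopfBC.toHom_comp {A B D : HopfBC C} (f : A ⟶ B) (g : B ⟶ D) :
    HopfBC.toHom (f ≫ g) = HopfBC.toHom f ≫ HopfBC.toHom g := rfl

/-- A bimonoid homomorphism, as a morphism of bicommutative Hopf monoids. -/
def HopfBC.homMk {A B : HopfBC C} (f : A.obj.X ⟶ B.obj.X) (hf : IsBimonHom f) : A ⟶ B :=
  ⟨⟨@Comon.Hom.mk _ _ _ A.obj.toBimon B.obj.toBimon (@Mon.Hom.mk _ _ _ (Bimon.mk'X A.obj.X)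
    (Bimon.mk'X B.obj.X) f hf.toIsMonHom)
    (@IsComonHom.mk _ _ _ _ _ (Bimon.mk' A.obj.X).comon (Bimon.mk' B.obj.X).comon _
      (Mon.Hom.ext hf.hom_counit) (Mon.Hom.ext hf.hom_comul))⟩⟩

@[simp]
lemma HopfBC.toHom_homMk {A B : HopfBC C} (f : A.obj.X ⟶ B.obj.X) (hf : IsBimonHom f) :
    HopfBC.toHom (HopfBC.homMk f hf) = f := rfl

end Bridge

lemma isIdempotentComplete_of_hasEqualizers (C : Type u) [Category.{v} C] [HasEqualizers C] :
    IsIdempotentComplete C :=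
  (Idempotents.isIdempotentComplete_iff_hasEqualizer_of_id_and_idempotent C).2
    fun _ _ _ => inferInstance

section Integral
variable {C : Type u} [Category.{v} C] [MonoidalCategory C] [BraidedCategory C]

/-- A normalized two-sided integral of a bimonoid. -/
structure IsIntegral {A : C} [BimonObj A] (σ : 𝟙_ C ⟶ A) : Prop where
  mul_left : A ◁ σ ≫ μ[A] = (ρ_ A).hom ≫ ε[A] ≫ σ
  mul_right : σ ▷ A ≫ μ[A] = (λ_ A).hom ≫ ε[A] ≫ σ
  counit : σ ≫ ε[A] = 𝟙 (𝟙_ C)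

/-- A normalized two-sided cointegral of a bimonoid. -/
structure IsCointegral {B : C} [BimonObj B] (φ : B ⟶ 𝟙_ C) : Prop where
  comul_left : Δ[B] ≫ B ◁ φ = φ ≫ η[B] ≫ (ρ_ B).inv
  comul_right : Δ[B] ≫ φ ▷ B = φ ≫ η[B] ≫ (λ_ B).inv
  one : η[B] ≫ φ = 𝟙 (𝟙_ C)

theorem IsIntegral.exists_left [HasEqualizers C] {A : C} [BimonObj A] {σ : 𝟙_ C ⟶ A}
    (h : IsIntegral σ) {X : C} (a : LeftAction A X) :
    ∃ (I : C) (i : I ⟶ X) (c : Cofork a.act (trivLeftAct A X)),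
      a.IsInvariant i ∧ Nonempty (IsColimit c) ∧ IsIso (i ≫ c.π) := by
  let e : X ⟶ X := (λ_ X).inv ≫ σ ▷ X ≫ a.act
  have act : A ◁ a.act ≫ a.act = (α_ A A X).inv ≫ μ[A] ▷ X ≫ a.act := by simp [a.mul_act]
  have h₁ : A ◁ e ≫ a.act = trivLeftAct A X ≫ e := by
    simp only [e, MonoidalCategory.whiskerLeft_comp, Category.assoc, act]
    rw [associator_inv_naturality_middle_assoc, ← comp_whiskerRight_assoc, h.mul_left]
    simp
  have he {Z : C} (f : Z ⟶ X) : f ≫ e = (λ_ Z).inv ≫ σ ▷ Z ≫ A ◁ f ≫ a.act := by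
    simp only [e, leftUnitor_inv_naturality_assoc, whisker_exchange_assoc]
  have h₂ : a.act ≫ e = trivLeftAct A X ≫ e := by
    rw [he, act, associator_inv_naturality_left_assoc, ← comp_whiskerRight_assoc, h.mul_right]
    simp [e]
  have h₃ {Z : C} (f : Z ⟶ X) (hf : A ◁ f ≫ a.act = trivLeftAct A Z ≫ f) : f ≫ e = f := by
    rw [he, hf, Category.assoc, ← comp_whiskerRight_assoc, h.counit]
    simp
  have h₄ {Z : C} (f : X ⟶ Z) (hf : a.act ≫ f = trivLeftAct A X ≫ f) : e ≫ f = f := by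
    simp only [e, Category.assoc, hf]
    rw [← comp_whiskerRight_assoc, h.counit]
    simp
  clear_value e
  have := isIdempotentComplete_of_hasEqualizers C
  obtain ⟨I, i, p, hip, hpi⟩ := IsIdempotentComplete.idempotents_split X e (h₃ e h₁)
  have hie : i ≫ e = i := by rw [← hpi, reassoc_of% hip]
  have hep : e ≫ p = p := by rw [← hpi, Category.assoc, hip, Category.comp_id]
  have hp : a.act ≫ p = trivLeftAct A X ≫ p := by
    rw [← hep, reassoc_of% h₂]
    simp only [Category.assoc]
  refine ⟨I, i, Cofork.ofπ p hp, ⟨?_, fun {Z} f hf => ⟨f ≫ p, ?_, fun g hg => ?_⟩⟩,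
    ⟨Cofork.IsColimit.mk _ (fun s => i ≫ s.π) (fun s => ?_) (fun s m hm => ?_)⟩, ?_⟩
  · rw [← hie, MonoidalCategory.whiskerLeft_comp, Category.assoc, h₁, trivLeftAct, Category.assoc,
      whisker_exchange_assoc]
    simp [hie]
  · dsimp only; rw [Category.assoc, hpi, h₃ f hf]
  · rw [← hg, Category.assoc, hip, Category.comp_id]
  · change p ≫ i ≫ s.π = s.π
    rw [reassoc_of% hpi, h₄ _ s.condition]
  · change p ≫ m = s.π at hm
    rw [← hm, reassoc_of% hip]
  · change IsIso (i ≫ p)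
    rw [hip]; infer_instance

theorem IsIntegral.exists_right [HasEqualizers C] {A : C} [BimonObj A] {σ : 𝟙_ C ⟶ A}
    (h : IsIntegral σ) {X : C} (a : RightAction X A) :
    ∃ (I : C) (i : I ⟶ X) (c : Cofork a.act (trivRightAct X A)),
      a.IsInvariant i ∧ Nonempty (IsColimit c) ∧ IsIso (i ≫ c.π) := by
  let e : X ⟶ X := (ρ_ X).inv ≫ X ◁ σ ≫ a.act
  have act : a.act ▷ A ≫ a.act = (α_ X A A).hom ≫ X ◁ μ[A] ≫ a.act := by simp [a.act_mul]
  have h₁ : e ▷ A ≫ a.act = trivRightAct X A ≫ e := by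
    simp only [e, comp_whiskerRight, Category.assoc, act]
    rw [associator_naturality_middle_assoc, ← whiskerLeft_comp_assoc, h.mul_right]
    simp
  have he {Z : C} (f : Z ⟶ X) : f ≫ e = (ρ_ Z).inv ≫ Z ◁ σ ≫ f ▷ A ≫ a.act := by
    simp only [e, rightUnitor_inv_naturality_assoc, ← whisker_exchange_assoc]
  have h₂ : a.act ≫ e = trivRightAct X A ≫ e := by
    rw [he, act, associator_naturality_right_assoc, ← whiskerLeft_comp_assoc, h.mul_left]
    simp [e]
  have h₃ {Z : C} (f : Z ⟶ X) (hf : f ▷ A ≫ a.act = trivRightAct Z A ≫ f) : f ≫ e = f := by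
    rw [he, hf, Category.assoc, ← whiskerLeft_comp_assoc, h.counit]
    simp
  have h₄ {Z : C} (f : X ⟶ Z) (hf : a.act ≫ f = trivRightAct X A ≫ f) : e ≫ f = f := by
    simp only [e, Category.assoc, hf]
    rw [← whiskerLeft_comp_assoc, h.counit]
    simp
  clear_value e
  have := isIdempotentComplete_of_hasEqualizers C
  obtain ⟨I, i, p, hip, hpi⟩ := IsIdempotentComplete.idempotents_split X e (h₃ e h₁)
  have hie : i ≫ e = i := by rw [← hpi, reassoc_of% hip]
  have hep : e ≫ p = p := by rw [← hpi, Category.assoc, hip, Category.comp_id]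
  have hp : a.act ≫ p = trivRightAct X A ≫ p := by
    rw [← hep, reassoc_of% h₂]
    simp only [Category.assoc]
  refine ⟨I, i, Cofork.ofπ p hp, ⟨?_, fun {Z} f hf => ⟨f ≫ p, ?_, fun g hg => ?_⟩⟩,
    ⟨Cofork.IsColimit.mk _ (fun s => i ≫ s.π) (fun s => ?_) (fun s m hm => ?_)⟩, ?_⟩
  · rw [← hie, comp_whiskerRight, Category.assoc, h₁, trivRightAct, Category.assoc,
      ← whisker_exchange_assoc]
    simp [hie]
  · dsimp only; rw [Category.assoc, hpi, h₃ f hf]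
  · rw [← hg, Category.assoc, hip, Category.comp_id]
  · change p ≫ i ≫ s.π = s.π
    rw [reassoc_of% hpi, h₄ _ s.condition]
  · change p ≫ m = s.π at hm
    rw [← hm, reassoc_of% hip]
  · change IsIso (i ≫ p)
    rw [hip]; infer_instance

theorem IsCointegral.exists_left [HasEqualizers C] {B : C} [BimonObj B] {φ : B ⟶ 𝟙_ C}
    (h : IsCointegral φ) {Y : C} (b : LeftCoaction B Y) :
    ∃ (Q : C) (p : Y ⟶ Q) (c : Fork b.coact (trivLeftCoact B Y)),
      b.IsInvariant p ∧ Nonempty (IsLimit c) ∧ IsIso (c.ι ≫ p) := by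
  let e : Y ⟶ Y := b.coact ≫ φ ▷ Y ≫ (λ_ Y).hom
  have coact : b.coact ≫ B ◁ b.coact = b.coact ≫ Δ[B] ▷ Y ≫ (α_ B B Y).hom := by
    rw [reassoc_of% b.coact_comul]; simp
  have h₁ : b.coact ≫ B ◁ e = e ≫ trivLeftCoact B Y := by
    simp only [e, MonoidalCategory.whiskerLeft_comp, Category.assoc, reassoc_of% coact]
    rw [← associator_naturality_middle_assoc, ← comp_whiskerRight_assoc, h.comul_left]
    simp only [comp_whiskerRight, Category.assoc, triangle, inv_hom_whiskerRight,
      Category.comp_id, Iso.hom_inv_id_assoc]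
  have he {Z : C} (f : Y ⟶ Z) : e ≫ f = b.coact ≫ B ◁ f ≫ φ ▷ Z ≫ (λ_ Z).hom := by
    simp only [e, Category.assoc, ← leftUnitor_naturality, ← whisker_exchange_assoc]
  have h₂ : e ≫ b.coact = e ≫ trivLeftCoact B Y := by
    rw [he, reassoc_of% coact, ← associator_naturality_left_assoc, ← comp_whiskerRight_assoc, h.comul_right]
    simp only [e, comp_whiskerRight, Category.assoc, leftUnitor_tensor_hom, Iso.hom_inv_id_assoc,
      inv_hom_whiskerRight, Category.comp_id]
  have h₃ {Z : C} (f : Y ⟶ Z) (hf : b.coact ≫ B ◁ f = f ≫ trivLeftCoact B Z) : e ≫ f = f := by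
    rw [he, reassoc_of% hf, ← comp_whiskerRight_assoc, h.one]
    simp
  have h₄ {Z : C} (f : Z ⟶ Y) (hf : f ≫ b.coact = f ≫ trivLeftCoact B Y) : f ≫ e = f := by
    simp only [e, reassoc_of% hf]
    rw [← comp_whiskerRight_assoc, h.one]
    simp
  clear_value e
  have := isIdempotentComplete_of_hasEqualizers C
  obtain ⟨I, i, p, hip, hpi⟩ := IsIdempotentComplete.idempotents_split Y e (h₃ e h₁)
  have hie : i ≫ e = i := by rw [← hpi, reassoc_of% hip]
  have hep : e ≫ p = p := by rw [← hpi, Category.assoc, hip, Category.comp_id]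
  have hi : i ≫ b.coact = i ≫ trivLeftCoact B Y := by
    rw [← hie, Category.assoc, h₂]
    simp only [Category.assoc]
  refine ⟨I, p, Fork.ofι i hi, ⟨?_, fun {Z} f hf => ⟨i ≫ f, ?_, fun g hg => ?_⟩⟩,
    ⟨Fork.IsLimit.mk _ (fun s => s.ι ≫ p) (fun s => ?_) (fun s m hm => ?_)⟩, ?_⟩
  · rw [← hep, MonoidalCategory.whiskerLeft_comp, reassoc_of% h₁, ← whisker_exchange,
      ← leftUnitor_inv_naturality_assoc, Category.assoc]
  · dsimp only; rw [reassoc_of% hpi, h₃ f hf]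
  · rw [← hg, reassoc_of% hip]
  · change (s.ι ≫ p) ≫ i = s.ι
    rw [Category.assoc, hpi, h₄ _ s.condition]
  · change m ≫ i = s.ι at hm
    rw [← hm, Category.assoc, hip]
    exact (Category.comp_id m).symm
  · change IsIso (i ≫ p)
    rw [hip]; infer_instance

theorem IsCointegral.exists_right [HasEqualizers C] {B : C} [BimonObj B] {φ : B ⟶ 𝟙_ C}
    (h : IsCointegral φ) {Y : C} (b : RightCoaction Y B) :
    ∃ (Q : C) (p : Y ⟶ Q) (c : Fork b.coact (trivRightCoact Y B)),
      b.IsInvariant p ∧ Nonempty (IsLimit c) ∧ IsIso (c.ι ≫ p) := by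
  let e : Y ⟶ Y := b.coact ≫ Y ◁ φ ≫ (ρ_ Y).hom
  have coact : b.coact ≫ b.coact ▷ B = b.coact ≫ Y ◁ Δ[B] ≫ (α_ Y B B).inv := by
    rw [reassoc_of% b.coact_comul]; simp
  have h₁ : b.coact ≫ e ▷ B = e ≫ trivRightCoact Y B := by
    simp only [e, comp_whiskerRight, Category.assoc, reassoc_of% coact]
    rw [← associator_inv_naturality_middle_assoc, ← whiskerLeft_comp_assoc, h.comul_right]
    simp only [MonoidalCategory.whiskerLeft_comp, Category.assoc, triangle_assoc_comp_right,
      whiskerLeft_inv_hom, Category.comp_id, Iso.hom_inv_id_assoc]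
  have he {Z : C} (f : Y ⟶ Z) : e ≫ f = b.coact ≫ f ▷ B ≫ Z ◁ φ ≫ (ρ_ Z).hom := by
    simp only [e, Category.assoc, ← rightUnitor_naturality, whisker_exchange_assoc]
  have h₂ : e ≫ b.coact = e ≫ trivRightCoact Y B := by
    rw [he, reassoc_of% coact, ← associator_inv_naturality_right_assoc, ← whiskerLeft_comp_assoc, h.comul_left]
    simp only [e, MonoidalCategory.whiskerLeft_comp, Category.assoc, rightUnitor_tensor_hom,
      Iso.inv_hom_id_assoc, Iso.hom_inv_id_assoc, whiskerLeft_inv_hom, Category.comp_id]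
  have h₃ {Z : C} (f : Y ⟶ Z) (hf : b.coact ≫ f ▷ B = f ≫ trivRightCoact Z B) : e ≫ f = f := by
    rw [he, reassoc_of% hf, ← whiskerLeft_comp_assoc, h.one]
    simp
  have h₄ {Z : C} (f : Z ⟶ Y) (hf : f ≫ b.coact = f ≫ trivRightCoact Y B) : f ≫ e = f := by
    simp only [e, reassoc_of% hf]
    rw [← whiskerLeft_comp_assoc, h.one]
    simp
  clear_value e
  have := isIdempotentComplete_of_hasEqualizers C
  obtain ⟨I, i, p, hip, hpi⟩ := IsIdempotentComplete.idempotents_split Y e (h₃ e h₁)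
  have hie : i ≫ e = i := by rw [← hpi, reassoc_of% hip]
  have hep : e ≫ p = p := by rw [← hpi, Category.assoc, hip, Category.comp_id]
  have hi : i ≫ b.coact = i ≫ trivRightCoact Y B := by
    rw [← hie, Category.assoc, h₂]
    simp only [Category.assoc]
  refine ⟨I, p, Fork.ofι i hi, ⟨?_, fun {Z} f hf => ⟨i ≫ f, ?_, fun g hg => ?_⟩⟩,
    ⟨Fork.IsLimit.mk _ (fun s => s.ι ≫ p) (fun s => ?_) (fun s m hm => ?_)⟩, ?_⟩
  · rw [← hep, comp_whiskerRight, reassoc_of% h₁, whisker_exchange,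
      ← rightUnitor_inv_naturality_assoc, Category.assoc]
  · dsimp only; rw [reassoc_of% hpi, h₃ f hf]
  · rw [← hg, reassoc_of% hip]
  · change (s.ι ≫ p) ≫ i = s.ι
    rw [Category.assoc, hpi, h₄ _ s.condition]
  · change m ≫ i = s.ι at hm
    rw [← hm, Category.assoc, hip]
    exact (Category.comp_id m).symm
  · change IsIso (i ≫ p)
    rw [hip]; infer_instance

theorem IsIntegral.isSmall [HasEqualizers C] {A : C} [BimonObj A] {σ : 𝟙_ C ⟶ A}
    (h : IsIntegral σ) : IsSmall A := ⟨h.exists_left, h.exists_right⟩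

theorem IsCointegral.isCosmall [HasEqualizers C] {B : C} [BimonObj B] {φ : B ⟶ 𝟙_ C}
    (h : IsCointegral φ) : IsCosmall B := ⟨h.exists_left, h.exists_right⟩

end Integral

section Small
variable {C : Type u} [Category.{v} C] [MonoidalCategory C] [BraidedCategory C]

/-- The left regular action. -/
@[simps]
def LeftAction.regular (A : C) [MonObj A] : LeftAction A A where
  act := μ[A]
  one_act := by simp
  mul_act := by simp

/-- The right regular action. -/
@[simps]
def RightAction.regular (A : C) [MonObj A] : RightAction A A where
  act := μ[A]
  act_one := by simp
  act_mul := by simp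

/-- The left regular coaction. -/
@[simps]
def LeftCoaction.regular (B : C) [ComonObj B] : LeftCoaction B B where
  coact := Δ[B]
  coact_counit := by simp
  coact_comul := by simp

/-- The right regular coaction. -/
@[simps]
def RightCoaction.regular (B : C) [ComonObj B] : RightCoaction B B where
  coact := Δ[B]
  coact_counit := by simp
  coact_comul := by simp

theorem IsSmall.exists_left_integral {A : C} [BimonObj A] (h : IsSmall A) :
    ∃ σ : 𝟙_ C ⟶ A, A ◁ σ ≫ μ[A] = (ρ_ A).hom ≫ ε[A] ≫ σ ∧ σ ≫ ε[A] = 𝟙 (𝟙_ C) := by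
  obtain ⟨I, i, c, hi, ⟨hc⟩, hiso⟩ := h.left (LeftAction.regular A)
  have hε : μ[A] ≫ ε[A] = trivLeftAct A A ≫ ε[A] := by
    simp [MonoidalCategory.tensorHom_def]
  have hk : c.π ≫ hc.desc (Cofork.ofπ ε[A] hε) = ε[A] := hc.fac _ WalkingParallelPair.one
  have hi' := hi.condition
  simp only [LeftAction.regular_act] at hi'
  refine ⟨η[A] ≫ c.π ≫ inv (i ≫ c.π) ≫ i, ?_, ?_⟩
  · simp only [MonoidalCategory.whiskerLeft_comp, Category.assoc, hi']
    rw [whisker_exchange_assoc, whisker_exchange_assoc, whisker_exchange_assoc]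
    simp [unitors_equal]
  · have : inv (i ≫ c.π) ≫ i ≫ ε[A] = hc.desc (Cofork.ofπ ε[A] hε) := by
      rw [IsIso.inv_comp_eq, Category.assoc, hk]
    simp only [Category.assoc, this, hk, BimonObj.one_counit]

theorem IsSmall.exists_right_integral {A : C} [BimonObj A] (h : IsSmall A) :
    ∃ σ : 𝟙_ C ⟶ A, σ ▷ A ≫ μ[A] = (λ_ A).hom ≫ ε[A] ≫ σ ∧ σ ≫ ε[A] = 𝟙 (𝟙_ C) := by
  obtain ⟨I, i, c, hi, ⟨hc⟩, hiso⟩ := h.right (RightAction.regular A)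
  have hε : μ[A] ≫ ε[A] = trivRightAct A A ≫ ε[A] := by
    simp [MonoidalCategory.tensorHom_def', unitors_equal]
  have hk : c.π ≫ hc.desc (Cofork.ofπ ε[A] hε) = ε[A] := hc.fac _ WalkingParallelPair.one
  have hi' := hi.condition
  simp only [RightAction.regular_act] at hi'
  refine ⟨η[A] ≫ c.π ≫ inv (i ≫ c.π) ≫ i, ?_, ?_⟩
  · simp only [comp_whiskerRight, Category.assoc, hi']
    rw [← whisker_exchange_assoc, ← whisker_exchange_assoc, ← whisker_exchange_assoc]
    simp [← unitors_equal]
  · have : inv (i ≫ c.π) ≫ i ≫ ε[A] = hc.desc (Cofork.ofπ ε[A] hε) := by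
      rw [IsIso.inv_comp_eq, Category.assoc, hk]
    simp only [Category.assoc, this, hk, BimonObj.one_counit]

theorem IsSmall.exists_integral {A : C} [BimonObj A] (h : IsSmall A) :
    ∃ σ : 𝟙_ C ⟶ A, IsIntegral σ := by
  obtain ⟨σ, hσ, hσ'⟩ := h.exists_left_integral
  obtain ⟨τ, hτ, hτ'⟩ := h.exists_right_integral
  have : σ = τ := by
    have h₁ : (ρ_ (𝟙_ C)).inv ≫ τ ▷ 𝟙_ C ≫ A ◁ σ ≫ μ[A] = σ := by
      rw [hσ, rightUnitor_naturality_assoc, reassoc_of% hτ', Iso.inv_hom_id_assoc]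
    have h₂ : (ρ_ (𝟙_ C)).inv ≫ τ ▷ 𝟙_ C ≫ A ◁ σ ≫ μ[A] = τ := by
      rw [← whisker_exchange_assoc, hτ, leftUnitor_naturality_assoc, reassoc_of% hσ',
        ← unitors_inv_equal, Iso.inv_hom_id_assoc]
    rw [← h₁, h₂]
  exact ⟨σ, hσ, this ▸ hτ, hσ'⟩

theorem IsCosmall.exists_left_cointegral {B : C} [BimonObj B] (h : IsCosmall B) :
    ∃ φ : B ⟶ 𝟙_ C, Δ[B] ≫ B ◁ φ = φ ≫ η[B] ≫ (ρ_ B).inv ∧ η[B] ≫ φ = 𝟙 (𝟙_ C) := by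
  obtain ⟨Q, p, c, hp, ⟨hc⟩, hiso⟩ := h.left (LeftCoaction.regular B)
  have hη : η[B] ≫ Δ[B] = η[B] ≫ trivLeftCoact B B := by
    rw [Bimon.one_comul, MonoidalCategory.tensorHom_def', leftUnitor_inv_naturality_assoc]
  have hk : hc.lift (Fork.ofι η[B] hη) ≫ c.ι = η[B] := hc.fac _ WalkingParallelPair.zero
  have hp' := hp.condition
  simp only [LeftCoaction.regular_coact] at hp'
  refine ⟨p ≫ inv (c.ι ≫ p) ≫ c.ι ≫ ε[B], ?_, ?_⟩
  · simp only [MonoidalCategory.whiskerLeft_comp, Category.assoc, reassoc_of% hp']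
    rw [← whisker_exchange_assoc, ← whisker_exchange_assoc, ← whisker_exchange]
    simp [unitors_inv_equal]
  · have : η[B] ≫ p ≫ inv (c.ι ≫ p) = hc.lift (Fork.ofι η[B] hη) := by
      rw [← Category.assoc, IsIso.comp_inv_eq, reassoc_of% hk]
    rw [reassoc_of% this, reassoc_of% hk, BimonObj.one_counit]

theorem IsCosmall.exists_right_cointegral {B : C} [BimonObj B] (h : IsCosmall B) :
    ∃ φ : B ⟶ 𝟙_ C, Δ[B] ≫ φ ▷ B = φ ≫ η[B] ≫ (λ_ B).inv ∧ η[B] ≫ φ = 𝟙 (𝟙_ C) := by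
  obtain ⟨Q, p, c, hp, ⟨hc⟩, hiso⟩ := h.right (RightCoaction.regular B)
  have hη : η[B] ≫ Δ[B] = η[B] ≫ trivRightCoact B B := by
    rw [Bimon.one_comul, MonoidalCategory.tensorHom_def, rightUnitor_inv_naturality_assoc,
      unitors_inv_equal]
  have hk : hc.lift (Fork.ofι η[B] hη) ≫ c.ι = η[B] := hc.fac _ WalkingParallelPair.zero
  have hp' := hp.condition
  simp only [RightCoaction.regular_coact] at hp'
  refine ⟨p ≫ inv (c.ι ≫ p) ≫ c.ι ≫ ε[B], ?_, ?_⟩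
  · simp only [comp_whiskerRight, Category.assoc, reassoc_of% hp']
    rw [whisker_exchange_assoc, whisker_exchange_assoc, whisker_exchange]
    simp [unitors_equal]
  · have : η[B] ≫ p ≫ inv (c.ι ≫ p) = hc.lift (Fork.ofι η[B] hη) := by
      rw [← Category.assoc, IsIso.comp_inv_eq, reassoc_of% hk]
    rw [reassoc_of% this, reassoc_of% hk, BimonObj.one_counit]

theorem IsCosmall.exists_cointegral {B : C} [BimonObj B] (h : IsCosmall B) :
    ∃ φ : B ⟶ 𝟙_ C, IsCointegral φ := by
  obtain ⟨φ, hφ, hφ'⟩ := h.exists_left_cointegral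
  obtain ⟨ψ, hψ, hψ'⟩ := h.exists_right_cointegral
  have : φ = ψ := by
    have h₁ : Δ[B] ≫ B ◁ φ ≫ ψ ▷ 𝟙_ C ≫ (ρ_ (𝟙_ C)).hom = φ := by
      rw [reassoc_of% hφ, ← rightUnitor_inv_naturality_assoc, reassoc_of% hψ', Iso.inv_hom_id,
        Category.comp_id]
    have h₂ : Δ[B] ≫ B ◁ φ ≫ ψ ▷ 𝟙_ C ≫ (ρ_ (𝟙_ C)).hom = ψ := by
      rw [whisker_exchange_assoc, reassoc_of% hψ, ← leftUnitor_inv_naturality_assoc,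
        reassoc_of% hφ', ← unitors_equal, Iso.inv_hom_id, Category.comp_id]
    rw [← h₁, h₂]
  exact ⟨φ, hφ, this ▸ hψ, hφ'⟩

end Small

section MulBy
variable {C : Type u} [Category.{v} C] [MonoidalCategory C]

/-- Left multiplication by a global element of a monoid. -/
def mulBy {B : C} [MonObj B] (t : 𝟙_ C ⟶ B) : B ⟶ B := (λ_ B).inv ≫ t ▷ B ≫ μ[B]

/-- Contraction of the left leg of the comultiplication with a functional. -/
def comulBy {B : C} [ComonObj B] (φ : B ⟶ 𝟙_ C) : B ⟶ B := Δ[B] ≫ φ ▷ B ≫ (λ_ B).hom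

lemma mulBy_whiskerRight_mul {B : C} [MonObj B] (t : 𝟙_ C ⟶ B) :
    mulBy t ▷ B ≫ μ[B] = μ[B] ≫ mulBy t := by
  simp only [mulBy, comp_whiskerRight, Category.assoc, MonObj.mul_assoc]
  rw [leftUnitor_inv_naturality_assoc, whisker_exchange_assoc]
  simp

lemma comul_comulBy_whiskerRight {B : C} [ComonObj B] (φ : B ⟶ 𝟙_ C) :
    Δ[B] ≫ comulBy φ ▷ B = comulBy φ ≫ Δ[B] := by
  simp only [comulBy, comp_whiskerRight, Category.assoc]
  rw [← leftUnitor_naturality, ← whisker_exchange_assoc, ComonObj.comul_assoc_assoc]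
  simp

lemma mulBy_comp {B D : C} [MonObj B] [MonObj D] (t : 𝟙_ C ⟶ B) (g : B ⟶ D) [IsMonHom g] :
    mulBy t ≫ g = g ≫ mulBy (t ≫ g) := by
  simp only [mulBy, Category.assoc, IsMonHom.mul_hom, comp_whiskerRight]
  rw [leftUnitor_inv_naturality_assoc, whisker_exchange_assoc, whisker_exchange_assoc,
    MonoidalCategory.tensorHom_def'_assoc, whisker_exchange_assoc]

lemma comp_comulBy {A B : C} [ComonObj A] [ComonObj B] (φ : B ⟶ 𝟙_ C) (f : A ⟶ B)
    [IsComonHom f] : f ≫ comulBy φ = comulBy (f ≫ φ) ≫ f := by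
  simp only [comulBy, Category.assoc, IsComonHom.hom_comul_assoc, comp_whiskerRight]
  rw [← leftUnitor_naturality, ← whisker_exchange_assoc, ← whisker_exchange_assoc,
    MonoidalCategory.tensorHom_def'_assoc]

variable [BraidedCategory C]

lemma whiskerLeft_mulBy_mul {B : C} [MonObj B] [IsCommMonObj B] (t : 𝟙_ C ⟶ B) :
    B ◁ mulBy t ≫ μ[B] = μ[B] ≫ mulBy t := by
  rw [← IsCommMonObj.mul_comm B, BraidedCategory.braiding_naturality_right_assoc,
    mulBy_whiskerRight_mul, Category.assoc]

lemma comul_whiskerLeft_comulBy {B : C} [ComonObj B] [IsCommComonObj B] (φ : B ⟶ 𝟙_ C) :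
    Δ[B] ≫ B ◁ comulBy φ = comulBy φ ≫ Δ[B] := by
  rw [← IsCommComonObj.comul_comm B, Category.assoc,
    ← BraidedCategory.braiding_naturality_left, reassoc_of% comul_comulBy_whiskerRight φ]

lemma IsIntegral.mulBy_eq {A : C} [BimonObj A] {σ : 𝟙_ C ⟶ A} (h : IsIntegral σ) :
    mulBy σ = ε[A] ≫ σ := by
  rw [mulBy, h.mul_right, Iso.inv_hom_id_assoc]

lemma IsCointegral.comulBy_eq {B : C} [BimonObj B] {φ : B ⟶ 𝟙_ C} (h : IsCointegral φ) :
    comulBy φ = φ ≫ η[B] := by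
  rw [comulBy, reassoc_of% h.comul_right, Iso.inv_hom_id, Category.comp_id]

lemma IsIntegral.mul_comp_mulBy {A B : C} [BimonObj A] [BimonObj B] {σ : 𝟙_ C ⟶ A}
    (h : IsIntegral σ) (f : A ⟶ B) [IsBimonHom f] :
    f ▷ B ≫ μ[B] ≫ mulBy (σ ≫ f) = trivLeftAct A B ≫ mulBy (σ ≫ f) := by
  rw [← mulBy_whiskerRight_mul, ← comp_whiskerRight_assoc, ← mulBy_comp, h.mulBy_eq]
  simp [mulBy]

lemma IsIntegral.mulBy_comp_of_invariant {A B : C} [BimonObj A] [BimonObj B] {σ : 𝟙_ C ⟶ A}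
    (h : IsIntegral σ) (f : A ⟶ B) {Z : C} (q : B ⟶ Z)
    (hq : f ▷ B ≫ μ[B] ≫ q = trivLeftAct A B ≫ q) : mulBy (σ ≫ f) ≫ q = q := by
  rw [mulBy, comp_whiskerRight, Category.assoc, Category.assoc, Category.assoc, hq,
    Category.assoc, ← comp_whiskerRight_assoc, h.counit]
  simp

lemma IsCointegral.comulBy_comp_comul {B D : C} [BimonObj B] [BimonObj D] {φ : D ⟶ 𝟙_ C}
    (h : IsCointegral φ) (g : B ⟶ D) [IsBimonHom g] :
    comulBy (g ≫ φ) ≫ Δ[B] ≫ g ▷ B = comulBy (g ≫ φ) ≫ trivLeftCoact D B := by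
  rw [← reassoc_of% comul_comulBy_whiskerRight, ← comp_whiskerRight, ← comp_comulBy, h.comulBy_eq]
  simp [comulBy]

lemma IsCointegral.comp_comulBy_of_invariant {B D : C} [BimonObj B] [BimonObj D] {φ : D ⟶ 𝟙_ C}
    (h : IsCointegral φ) (g : B ⟶ D) {Z : C} (q : Z ⟶ B)
    (hq : q ≫ Δ[B] ≫ g ▷ B = q ≫ trivLeftCoact D B) : q ≫ comulBy (g ≫ φ) = q := by
  rw [comulBy, comp_whiskerRight, Category.assoc, reassoc_of% hq, ← comp_whiskerRight_assoc, h.one]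
  simp

/-- Extension of an integral along a section of the quotient map which is compatible with the
integral of the kernel. -/
theorem IsIntegral.extension {B D : C} [BimonObj B] [BimonObj D] [IsCommMonObj B]
    {t : 𝟙_ C ⟶ B} {τ : 𝟙_ C ⟶ D} (hτ : IsIntegral τ)
    (g : B ⟶ D) [IsBimonHom g] (s : D ⟶ B) (hs : s ≫ g = 𝟙 D) (hgs : g ≫ s = mulBy t) :
    IsIntegral (τ ≫ s) := by
  have lin : B ◁ s ≫ μ[B] = g ▷ D ≫ μ[D] ≫ s := by
    calc B ◁ s ≫ μ[B] = B ◁ (s ≫ g ≫ s) ≫ μ[B] := by rw [reassoc_of% hs]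
      _ = B ◁ s ≫ μ[B] ≫ g ≫ s := by
        rw [MonoidalCategory.whiskerLeft_comp, Category.assoc, hgs, whiskerLeft_mulBy_mul]
      _ = (B ◁ s ≫ (g ⊗ₘ g)) ≫ μ[D] ≫ s := by rw [IsMonHom.mul_hom_assoc, Category.assoc]
      _ = g ▷ D ≫ μ[D] ≫ s := by
        rw [← id_tensorHom, tensorHom_comp_tensorHom, hs, Category.id_comp, tensorHom_id]
  have left : B ◁ (τ ≫ s) ≫ μ[B] = (ρ_ B).hom ≫ ε[B] ≫ τ ≫ s := by
    rw [MonoidalCategory.whiskerLeft_comp, Category.assoc, lin, whisker_exchange_assoc,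
      reassoc_of% hτ.mul_left, rightUnitor_naturality_assoc, IsComonHom.hom_counit_assoc]
  refine ⟨left, ?_, ?_⟩
  · rw [← IsCommMonObj.mul_comm B, BraidedCategory.braiding_naturality_left_assoc, left]
    simp
  · rw [← IsComonHom.hom_counit g, Category.assoc, reassoc_of% hs, hτ.counit]

/-- Extension of a cointegral along a retraction of the kernel map which is compatible with the
cointegral of the cokernel. -/
theorem IsCointegral.extension {A B : C} [BimonObj A] [BimonObj B] [IsCommComonObj B]
    {t : B ⟶ 𝟙_ C} {ψ : A ⟶ 𝟙_ C} (hψ : IsCointegral ψ)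
    (f : A ⟶ B) [IsBimonHom f] (r : B ⟶ A) (hr : f ≫ r = 𝟙 A) (hrf : r ≫ f = comulBy t) :
    IsCointegral (r ≫ ψ) := by
  have colin : Δ[B] ≫ B ◁ r = r ≫ Δ[A] ≫ f ▷ A := by
    calc Δ[B] ≫ B ◁ r = Δ[B] ≫ B ◁ ((r ≫ f) ≫ r) := by rw [Category.assoc, hr, Category.comp_id]
      _ = r ≫ f ≫ Δ[B] ≫ B ◁ r := by
        rw [MonoidalCategory.whiskerLeft_comp, hrf, reassoc_of% comul_whiskerLeft_comulBy, ← hrf,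
          Category.assoc]
      _ = r ≫ Δ[A] ≫ (f ⊗ₘ f) ≫ B ◁ r := by rw [IsComonHom.hom_comul_assoc]
      _ = r ≫ Δ[A] ≫ f ▷ A := by
        rw [← id_tensorHom, tensorHom_comp_tensorHom, hr, Category.comp_id, tensorHom_id]
  have left : Δ[B] ≫ B ◁ (r ≫ ψ) = (r ≫ ψ) ≫ η[B] ≫ (ρ_ B).inv := by
    rw [MonoidalCategory.whiskerLeft_comp, reassoc_of% colin, ← whisker_exchange,
      reassoc_of% hψ.comul_left, ← rightUnitor_inv_naturality, IsMonHom.one_hom_assoc,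
      Category.assoc]
  refine ⟨left, ?_, ?_⟩
  · rw [← IsCommComonObj.comul_comm B, Category.assoc, ← BraidedCategory.braiding_naturality_right,
      reassoc_of% left]
    simp
  · rw [← IsMonHom.one_hom f, Category.assoc, reassoc_of% hr, hψ.one]

end MulBy

section Quotient
variable {C : Type u} [Category.{v} C] [MonoidalCategory C]

lemma tensorHom_trivLeftAct {A A' X X' : C} [ComonObj A] [ComonObj A'] (u : A ⟶ A')
    (hu : u ≫ ε[A'] = ε[A]) (v : X ⟶ X') :
    (u ⊗ₘ v) ≫ trivLeftAct A' X' = trivLeftAct A X ≫ v := by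
  rw [trivLeftAct, MonoidalCategory.tensorHom_def', Category.assoc, ← comp_whiskerRight_assoc, hu,
    whisker_exchange_assoc, leftUnitor_naturality, Category.assoc]

lemma trivLeftCoact_tensorHom {B B' Y Y' : C} [MonObj B] [MonObj B'] (u : B ⟶ B')
    (hu : η[B] ≫ u = η[B']) (v : Y ⟶ Y') :
    (λ_ Y).inv ≫ η[B] ▷ Y ≫ (u ⊗ₘ v) = v ≫ trivLeftCoact B' Y' := by
  rw [trivLeftCoact, MonoidalCategory.tensorHom_def, ← comp_whiskerRight_assoc, hu,
    ← whisker_exchange, leftUnitor_inv_naturality_assoc]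

variable [BraidedCategory C]

lemma comul_counit_tensor (A : C) [ComonObj A] : Δ[A] ≫ ε[A ⊗ A] = ε[A] := by
  rw [Comon.tensorObj_counit, ComonObj.counit_comul_hom_assoc]
  simp

lemma one_tensor_mul (B : C) [MonObj B] : η[B ⊗ B] ≫ μ[B] = η[B] := by
  rw [MonObj.tensorObj.one_def, Category.assoc, MonObj.one_mul_hom]
  simp

lemma isCommMonObj_of_isSplitEpi {B Q : C} [MonObj B] [MonObj Q] [IsCommMonObj B] (π : B ⟶ Q)
    [IsMonHom π] [IsSplitEpi π] : IsCommMonObj Q where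
  mul_comm := by
    rw [← cancel_epi (π ⊗ₘ π), BraidedCategory.braiding_naturality_assoc, ← IsMonHom.mul_hom,
      IsCommMonObj.mul_comm_assoc]

lemma isCommComonObj_of_isSplitEpi {B Q : C} [ComonObj B] [ComonObj Q] [IsCommComonObj B]
    (π : B ⟶ Q) [IsComonHom π] [IsSplitEpi π] : IsCommComonObj Q where
  comul_comm := by
    rw [← cancel_epi π, IsComonHom.hom_comul_assoc, BraidedCategory.braiding_naturality,
      IsCommComonObj.comul_comm_assoc, IsComonHom.hom_comul]

lemma isCommMonObj_of_isSplitMono {K B : C} [MonObj K] [MonObj B] [IsCommMonObj B] (i : K ⟶ B)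
    [IsMonHom i] [IsSplitMono i] : IsCommMonObj K where
  mul_comm := by
    rw [← cancel_mono i, Category.assoc, IsMonHom.mul_hom,
      ← BraidedCategory.braiding_naturality_assoc, IsCommMonObj.mul_comm]

lemma isCommComonObj_of_isSplitMono {K B : C} [ComonObj K] [ComonObj B] [IsCommComonObj B]
    (i : K ⟶ B) [IsComonHom i] [IsSplitMono i] : IsCommComonObj K where
  comul_comm := by
    rw [← cancel_mono (i ⊗ₘ i), Category.assoc, ← BraidedCategory.braiding_naturality,
      ← IsComonHom.hom_comul, ← IsComonHom.hom_comul_assoc, IsCommComonObj.comul_comm]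

lemma isBimonHom_of_splitEpi_comp {B Q D : C} [BimonObj B] [BimonObj Q] [BimonObj D] (π : B ⟶ Q)
    [IsBimonHom π] [IsSplitEpi π] (k : Q ⟶ D) (h : IsBimonHom (π ≫ k)) : IsBimonHom k where
  one_hom := by rw [← IsMonHom.one_hom π, Category.assoc, h.one_hom]
  mul_hom := by
    rw [← cancel_epi (π ⊗ₘ π), ← IsMonHom.mul_hom_assoc, h.mul_hom, tensorHom_comp_tensorHom_assoc]
  hom_counit := by
    rw [← cancel_epi π, ← Category.assoc, h.hom_counit, IsComonHom.hom_counit]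
  hom_comul := by
    rw [← cancel_epi π, ← Category.assoc, h.hom_comul, IsComonHom.hom_comul_assoc,
      tensorHom_comp_tensorHom]

lemma isBimonHom_of_comp_splitMono {A K B : C} [BimonObj A] [BimonObj K] [BimonObj B] (k : A ⟶ K)
    (i : K ⟶ B) [IsBimonHom i] [IsSplitMono i] (h : IsBimonHom (k ≫ i)) : IsBimonHom k where
  one_hom := by
    rw [← cancel_mono i, Category.assoc, h.one_hom, IsMonHom.one_hom]
  mul_hom := by
    rw [← cancel_mono i, Category.assoc, h.mul_hom, Category.assoc, IsMonHom.mul_hom,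
      tensorHom_comp_tensorHom_assoc]
  hom_counit := by rw [← IsComonHom.hom_counit i, ← Category.assoc, h.hom_counit]
  hom_comul := by
    rw [← cancel_mono (i ⊗ₘ i), Category.assoc, ← IsComonHom.hom_comul, ← Category.assoc,
      h.hom_comul, Category.assoc, tensorHom_comp_tensorHom]

/-- If `A` has a normalized integral `σ`, then the idempotent of `B` given by multiplication with
the image of `σ` splits through a Hopf monoid quotient of `B` on which `A` becomes trivial. -/
theorem IsIntegral.exists_quotient [HasEqualizers C] {A B : C} [HopfObj A] [HopfObj B]
    [IsCommMonObj B] {σ : 𝟙_ C ⟶ A} (h : IsIntegral σ) (f : A ⟶ B) [IsBimonHom f] :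
    ∃ (Q : C) (_ : HopfObj Q) (π : B ⟶ Q) (s : Q ⟶ B), IsBimonHom π ∧ s ≫ π = 𝟙 Q ∧
      π ≫ s = mulBy (σ ≫ f) ∧ f ≫ π = ε[A] ≫ η[Q] := by
  have := isIdempotentComplete_of_hasEqualizers C
  obtain ⟨Q, s, π, hsπ, hπs⟩ := IsIdempotentComplete.idempotents_split B (mulBy (σ ≫ f))
    (h.mulBy_comp_of_invariant f _ (h.mul_comp_mulBy f))
  have inv {Z : C} (q : B ⟶ Z) (hq : f ▷ B ≫ μ[B] ≫ q = trivLeftAct A B ≫ q) :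
      π ≫ s ≫ q = q := by
    rw [reassoc_of% hπs, h.mulBy_comp_of_invariant f q hq]
  have heπ : mulBy (σ ≫ f) ≫ π = π := by rw [← hπs, Category.assoc, hsπ, Category.comp_id]
  have hπ : f ▷ B ≫ μ[B] ≫ π = trivLeftAct A B ≫ π := by
    have := h.mul_comp_mulBy f =≫ π
    simpa only [Category.assoc, heπ] using this
  have : IsSplitEpi π := ⟨⟨⟨s, hsπ⟩⟩⟩
  have hm : (π ⊗ₘ π) ≫ (s ⊗ₘ s) ≫ μ[B] ≫ π = μ[B] ≫ π := by
    rw [tensorHom_comp_tensorHom_assoc, hπs, MonoidalCategory.tensorHom_def, Category.assoc,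
      reassoc_of% whiskerLeft_mulBy_mul (B := B), reassoc_of% mulBy_whiskerRight_mul (B := B),
      heπ, heπ]
  have hd : π ≫ s ≫ Δ[B] ≫ (π ⊗ₘ π) = Δ[B] ≫ (π ⊗ₘ π) := by
    refine inv _ ?_
    rw [BimonObj.mul_comul_assoc, tensorHom_comp_tensorHom]
    have h₃ : f ▷ B ≫ (Δ[B] ⊗ₘ Δ[B]) = (Δ[A] ⊗ₘ Δ[B]) ≫ ((f ⊗ₘ f) ▷ (B ⊗ B)) := by
      rw [← tensorHom_id, ← tensorHom_id, tensorHom_comp_tensorHom, tensorHom_comp_tensorHom,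
        IsComonHom.hom_comul, Category.id_comp, Category.comp_id]
    rw [reassoc_of% h₃, tensorμ_natural_left_assoc, tensorHom_comp_tensorHom, hπ,
      ← tensorHom_comp_tensorHom, reassoc_of% tensorμ_trivLeftAct A B A B,
      reassoc_of% tensorHom_trivLeftAct _ (comul_counit_tensor A), Category.assoc]
  have he : π ≫ s ≫ ε[B] = ε[B] := by
    refine inv _ ?_
    simp [MonoidalCategory.tensorHom_def, ← comp_whiskerRight_assoc]
  have hS : π ≫ s ≫ HopfObj.antipode ≫ π = HopfObj.antipode ≫ π := by
    refine inv _ ?_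
    have h₃ : f ▷ B ≫ (HopfObj.antipode (X := B) ⊗ₘ HopfObj.antipode (X := B)) =
        (HopfObj.antipode (X := A) ⊗ₘ HopfObj.antipode (X := B)) ≫ f ▷ B := by
      rw [← tensorHom_id, tensorHom_comp_tensorHom, tensorHom_comp_tensorHom,
        HopfObj.hom_antipode, Category.id_comp, Category.comp_id]
    rw [reassoc_of% HopfObj.mul_antipode, IsCommMonObj.mul_comm_assoc, reassoc_of% h₃, hπ,
      ← Category.assoc, tensorHom_trivLeftAct _ (HopfObj.antipode_counit A), Category.assoc]
  let hQ : HopfObj Q := hopfObjOfSplitEpi π ((s ⊗ₘ s) ≫ μ[B] ≫ π) (s ≫ Δ[B] ≫ (π ⊗ₘ π))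
    (s ≫ ε[B]) (s ≫ HopfObj.antipode ≫ π) hm hd he hS
  refine ⟨Q, hQ, π, s, { one_hom := rfl, mul_hom := hm.symm, hom_counit := he, hom_comul := hd },
    hsπ, hπs, ?_⟩
  change f ≫ π = ε[A] ≫ η[B] ≫ π
  have h₁ : (ρ_ A).inv ≫ A ◁ η[B] ≫ f ▷ B ≫ μ[B] = f := by
    rw [whisker_exchange_assoc]; simp
  conv_lhs => rw [← h₁]
  rw [Category.assoc, Category.assoc, Category.assoc, hπ, Category.assoc, whisker_exchange_assoc]
  simp [unitors_equal]

/-- If `D` has a normalized cointegral `φ`, then the idempotent of `B` given by contraction with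
the pullback of `φ` splits through a Hopf submonoid of `B` on which the map to `D` is trivial. -/
theorem IsCointegral.exists_sub [HasEqualizers C] {B D : C} [HopfObj B] [HopfObj D]
    [IsCommMonObj B] [IsCommComonObj B] {φ : D ⟶ 𝟙_ C} (h : IsCointegral φ) (g : B ⟶ D)
    [IsBimonHom g] :
    ∃ (K : C) (_ : HopfObj K) (i : K ⟶ B) (p : B ⟶ K), IsBimonHom i ∧ i ≫ p = 𝟙 K ∧
      p ≫ i = comulBy (g ≫ φ) ∧ i ≫ g = ε[K] ≫ η[D] := by
  have := isIdempotentComplete_of_hasEqualizers C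
  obtain ⟨K, i, p, hip, hpi⟩ := IsIdempotentComplete.idempotents_split B (comulBy (g ≫ φ))
    (h.comp_comulBy_of_invariant g _ (h.comulBy_comp_comul g))
  have inv {Z : C} (q : Z ⟶ B) (hq : q ≫ Δ[B] ≫ g ▷ B = q ≫ trivLeftCoact D B) :
      q ≫ p ≫ i = q := by
    rw [hpi, h.comp_comulBy_of_invariant g q hq]
  have hie : i ≫ comulBy (g ≫ φ) = i := by rw [← hpi, reassoc_of% hip]
  have hi : i ≫ Δ[B] ≫ g ▷ B = i ≫ trivLeftCoact D B := by
    have := i ≫= h.comulBy_comp_comul g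
    rwa [reassoc_of% hie, reassoc_of% hie] at this
  have : IsSplitMono i := ⟨⟨⟨p, hip⟩⟩⟩
  have hd : (i ≫ Δ[B] ≫ (p ⊗ₘ p)) ≫ (i ⊗ₘ i) = i ≫ Δ[B] := by
    rw [Category.assoc, Category.assoc, tensorHom_comp_tensorHom, hpi,
      MonoidalCategory.tensorHom_def, reassoc_of% comul_comulBy_whiskerRight (B := B),
      comul_whiskerLeft_comulBy, reassoc_of% hie, reassoc_of% hie]
  have hm : ((i ⊗ₘ i) ≫ μ[B] ≫ p) ≫ i = (i ⊗ₘ i) ≫ μ[B] := by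
    rw [Category.assoc, Category.assoc, ← Category.assoc]
    refine inv _ ?_
    have h₁ := whiskerRight_tensorμ g g B B
    have h₃ : (μ[B] ⊗ₘ μ[B]) ≫ g ▷ B = (g ⊗ₘ g) ▷ (B ⊗ B) ≫ (μ[D] ⊗ₘ μ[B]) := by
      rw [← tensorHom_id, ← tensorHom_id, tensorHom_comp_tensorHom, tensorHom_comp_tensorHom,
        IsMonHom.mul_hom, Category.id_comp, Category.comp_id]
    rw [Category.assoc, BimonObj.mul_comul_assoc, Category.assoc, h₃, ← reassoc_of% h₁,
      tensorHom_comp_tensorHom_assoc, tensorHom_comp_tensorHom_assoc, Category.assoc, hi,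
      ← tensorHom_comp_tensorHom_assoc, reassoc_of% trivLeftCoact_tensorμ D B D B,
      trivLeftCoact_tensorHom _ (one_tensor_mul D)]
  have ho : (η[B] ≫ p) ≫ i = η[B] := by
    rw [Category.assoc]
    refine inv _ ?_
    rw [Bimon.one_comul_assoc, leftUnitor_inv_naturality_assoc,
      MonoidalCategory.tensorHom_def', Category.assoc, ← comp_whiskerRight, IsMonHom.one_hom]
  have hS : (i ≫ HopfObj.antipode ≫ p) ≫ i = i ≫ HopfObj.antipode := by
    rw [Category.assoc, Category.assoc, ← Category.assoc]
    refine inv _ ?_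
    have h₃ : (HopfObj.antipode (X := B) ⊗ₘ HopfObj.antipode (X := B)) ≫ g ▷ B =
        g ▷ B ≫ (HopfObj.antipode (X := D) ⊗ₘ HopfObj.antipode (X := B)) := by
      rw [← tensorHom_id, tensorHom_comp_tensorHom, tensorHom_comp_tensorHom,
        HopfObj.hom_antipode, Category.id_comp, Category.comp_id]
    rw [Category.assoc, reassoc_of% HopfObj.antipode_comul, IsCommComonObj.comul_comm_assoc, h₃,
      reassoc_of% hi, trivLeftCoact_tensorHom _ (HopfObj.one_antipode D), Category.assoc]
  let hK : HopfObj K := hopfObjOfSplitMono i (η[B] ≫ p) ((i ⊗ₘ i) ≫ μ[B] ≫ p)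
    (i ≫ Δ[B] ≫ (p ⊗ₘ p)) (i ≫ HopfObj.antipode ≫ p) ho hm hd hS
  refine ⟨K, hK, i, p,
    { one_hom := ho, mul_hom := hm, hom_counit := rfl, hom_comul := hd.symm }, hip, hpi, ?_⟩
  change i ≫ g = (i ≫ ε[B]) ≫ η[D]
  have h₁ : Δ[B] ≫ g ▷ B ≫ D ◁ ε[B] ≫ (ρ_ D).hom = g := by
    rw [← whisker_exchange_assoc]; simp
  conv_lhs => rw [← h₁]
  rw [reassoc_of% hi, ← whisker_exchange_assoc]
  simp [← unitors_equal]

end Quotient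

section Extension
variable {C : Type u} [Category.{v} C] [MonoidalCategory C] [BraidedCategory C]

instance HopfBC.isCommMonObj (A : HopfBC C) : IsCommMonObj A.obj.X := A.property.1

instance HopfBC.isCommComonObj (A : HopfBC C) : IsCommComonObj A.obj.X := A.property.2

lemma isBimonHom_counit_one (A B : C) [BimonObj A] [BimonObj B] :
    IsBimonHom (ε[A] ≫ η[B]) where
  one_hom := by simp
  mul_hom := by
    rw [Bimon.mul_counit_assoc, ← tensorHom_comp_tensorHom_assoc, MonObj.one_mul_hom]
  hom_counit := by simp
  hom_comul := by
    rw [Category.assoc, Bimon.one_comul, ← tensorHom_comp_tensorHom,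
      ComonObj.counit_comul_hom_assoc]

variable [Preadditive (HopfBC C)]

lemma HopfBC.toHom_zero (A B : HopfBC C) : HopfBC.toHom (0 : A ⟶ B) = ε[A.obj.X] ≫ η[B.obj.X] := by
  let z : A ⟶ A := HopfBC.homMk _ (isBimonHom_counit_one A.obj.X A.obj.X)
  have h : z ≫ (0 : A ⟶ B) = HopfBC.homMk _ (isBimonHom_counit_one A.obj.X B.obj.X) := by
    apply HopfBC.toHom_injective
    rw [HopfBC.toHom_comp, HopfBC.toHom_homMk, HopfBC.toHom_homMk, Category.assoc,
      IsMonHom.one_hom]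
  rw [← HopfBC.toHom_homMk _ (isBimonHom_counit_one A.obj.X B.obj.X), ← h, comp_zero]

variable [HasEqualizers C]

theorem HopfBC.isSmall_of_isCokernel {A B D : HopfBC C} {f : A ⟶ B} {g : B ⟶ D} (w : f ≫ g = 0)
    (hg : IsColimit (CokernelCofork.ofπ g w)) (hA : IsSmall A.obj.X) (hD : IsSmall D.obj.X) :
    IsSmall B.obj.X := by
  obtain ⟨σ, hσ⟩ := hA.exists_integral
  obtain ⟨τ, hτ⟩ := hD.exists_integral
  obtain ⟨Q, _, π, s, hπ, hsπ, hπs, hfπ⟩ := hσ.exists_quotient (HopfBC.toHom f)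
  have : IsSplitEpi π := ⟨⟨⟨s, hsπ⟩⟩⟩
  let Q' : HopfBC C := ⟨⟨Q⟩, isCommMonObj_of_isSplitEpi π, isCommComonObj_of_isSplitEpi π⟩
  let π' : B ⟶ Q' := HopfBC.homMk (B := Q') π hπ
  have hfπ' : f ≫ π' = 0 := by
    apply HopfBC.toHom_injective
    rw [HopfBC.toHom_comp, HopfBC.toHom_zero]
    exact hfπ
  have hfg : HopfBC.toHom f ≫ HopfBC.toHom g = ε[A.obj.X] ≫ η[D.obj.X] := by
    rw [← HopfBC.toHom_comp, w, HopfBC.toHom_zero]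
  have hk : π ≫ s ≫ HopfBC.toHom g = HopfBC.toHom g := by
    rw [reassoc_of% hπs]
    refine hσ.mulBy_comp_of_invariant _ _ ?_
    rw [IsMonHom.mul_hom, ← tensorHom_id, tensorHom_comp_tensorHom_assoc, hfg, Category.id_comp,
      MonoidalCategory.tensorHom_def, Category.assoc, comp_whiskerRight, Category.assoc,
      ← whisker_exchange_assoc, MonObj.one_mul, Category.assoc, leftUnitor_naturality]
  let k : Q' ⟶ D := HopfBC.homMk (A := Q') (s ≫ HopfBC.toHom g)
    (isBimonHom_of_splitEpi_comp π _ (by rw [hk]; infer_instance))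
  have hπk : π' ≫ k = g := HopfBC.toHom_injective hk
  let l : D ⟶ Q' := hg.desc (CokernelCofork.ofπ π' hfπ')
  have hl : g ≫ l = π' := hg.fac (CokernelCofork.ofπ π' hfπ') WalkingParallelPair.one
  have hlk : l ≫ k = 𝟙 D := Cofork.IsColimit.hom_ext hg (by
    change g ≫ l ≫ k = g ≫ 𝟙 D
    rw [reassoc_of% hl, hπk, Category.comp_id])
  refine (hτ.extension (t := σ ≫ HopfBC.toHom f) (HopfBC.toHom g) (HopfBC.toHom l ≫ s)
    ?_ ?_).isSmall
  · rw [Category.assoc]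
    exact congrArg HopfBC.toHom hlk
  · rw [← hπs, ← Category.assoc]
    exact congrArg (· ≫ s) (congrArg HopfBC.toHom hl)

theorem HopfBC.isCosmall_of_isKernel {A B D : HopfBC C} {f : A ⟶ B} {g : B ⟶ D} (w : f ≫ g = 0)
    (hf : IsLimit (KernelFork.ofι f w)) (hA : IsCosmall A.obj.X) (hD : IsCosmall D.obj.X) :
    IsCosmall B.obj.X := by
  obtain ⟨ψ, hψ⟩ := hA.exists_cointegral
  obtain ⟨φ, hφ⟩ := hD.exists_cointegral
  obtain ⟨K, _, i, p, hi, hip, hpi, hig⟩ := hφ.exists_sub (HopfBC.toHom g)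
  have : IsSplitMono i := ⟨⟨⟨p, hip⟩⟩⟩
  let K' : HopfBC C := ⟨⟨K⟩, isCommMonObj_of_isSplitMono i, isCommComonObj_of_isSplitMono i⟩
  let i' : K' ⟶ B := HopfBC.homMk (A := K') i hi
  have hig' : i' ≫ g = 0 := by
    apply HopfBC.toHom_injective
    rw [HopfBC.toHom_comp, HopfBC.toHom_zero]
    exact hig
  have hfg : HopfBC.toHom f ≫ HopfBC.toHom g = ε[A.obj.X] ≫ η[D.obj.X] := by
    rw [← HopfBC.toHom_comp, w, HopfBC.toHom_zero]
  have hk : (HopfBC.toHom f ≫ p) ≫ i = HopfBC.toHom f := by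
    rw [Category.assoc, hpi]
    refine hφ.comp_comulBy_of_invariant _ _ ?_
    rw [IsComonHom.hom_comul_assoc, ← tensorHom_id, tensorHom_comp_tensorHom, hfg,
      Category.comp_id, MonoidalCategory.tensorHom_def, comp_whiskerRight, Category.assoc,
      ComonObj.counit_comul_assoc, ← whisker_exchange, leftUnitor_inv_naturality_assoc]
  let k : A ⟶ K' := HopfBC.homMk (B := K') (HopfBC.toHom f ≫ p)
    (isBimonHom_of_comp_splitMono _ i (by rw [hk]; infer_instance))
  have hki : k ≫ i' = f := HopfBC.toHom_injective hk
  let l : K' ⟶ A := hf.lift (KernelFork.ofι i' hig')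
  have hl : l ≫ f = i' := hf.fac (KernelFork.ofι i' hig') WalkingParallelPair.zero
  have hkl : k ≫ l = 𝟙 A := Fork.IsLimit.hom_ext hf (by
    change (k ≫ l) ≫ f = 𝟙 A ≫ f
    rw [Category.assoc, hl, hki, Category.id_comp])
  refine (hψ.extension (t := HopfBC.toHom g ≫ φ) (HopfBC.toHom f) (p ≫ HopfBC.toHom l)
    ?_ ?_).isCosmall
  · rw [← Category.assoc]
    exact congrArg HopfBC.toHom hkl
  · rw [← hpi, Category.assoc]
    exact congrArg (p ≫ ·) (congrArg HopfBC.toHom hl)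

end Extension

end HopfExt

/-- Bismall bicommutative Hopf monoids are closed under extensions. The normalized (co)integrals
of the outer terms split the relevant (co)equalizers in `C`, so that these are absolute and
bistability is not used. -/
theorem theorem201907312238 {C : Type u} [Category.{v} C] [MonoidalCategory C]
    [SymmetricCategory C] [HasEqualizers C] [HasCoequalizers C]
    (hC : HopfExt.IsBistable C) [Abelian (HopfExt.HopfBC C)] :
    (HopfExt.isBismall C).IsClosedUnderExtensions where
  prop_X₂_of_shortExact {S} hS hA hD := by
    have := hS.mono_f
    have := hS.epi_g
    exact ⟨HopfExt.HopfBC.isSmall_of_isCokernel S.zero hS.exact.gIsCokernel hA.small hD.small,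
      HopfExt.HopfBC.isCosmall_of_isKernel S.zero hS.exact.fIsKernel hA.cosmall hD.cosmall⟩
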